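/- **Theorem 5 (Firewall paradox).** All systems are finite-dimensional. *The game.* Physicists indicate a qubit $Q_{\rm Ref}$ and issue predictions $(P,\bar P)$; by a fair coin, the referee measures $Q_{\rm Ref}$ in the computational basis and compares with $P$, or in the diagonal basis and compares with $\bar P$. Every quantum strategy wins with probability at most $\frac12+\frac1{\sqrt8}$. *Tolerance.* Let $0<\eta<\frac12-\frac1{\sqrt8}$; "certain" means: with probability at least $1-\eta$; "maximally entangled" means: with fidelity at least $1-\eta/4$ to $\sqrt{1/2}\,(|00\rangle+|11\rangle)$. *The strategy.* $A$, $B$ are the field modes just inside and just outside the horizon, $Q_{\rm Ref}$ is a qubit tensor factor of $B$, $R$ is the early radiation collected by the outside physicist Bob, and $R'$ is the radiation still to come. Freely falling Alice applies to $A$, and Bob to $R$, an isometry that distils a qubit maximally entangled with $Q_{\rm Ref}$ (it succeeds whenever some isometry does). Alice measures her qubit in the computational basis and records $m$; Bob measures his in the diagonal basis, records $\bar m$ in a register that is classical for Alice, and sends it to her. She reads it, is then certain that Bob is certain that his outcome is $\bar m$, and issues $(P,\bar P)=(m,\bar m)$. *Assumptions.* - **Executability:** the strategy is executed. - **(Q)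 Universality of quantum theory:** (i) states are density operators; from the outcome of his or her own measurement, each physicist infers outcomes of the referee's tests by the state update and Born rules, and each physicist can simulate this reasoning of another physicist of whose recorded outcome he or she is certain that the other is certain; (ii) for each physicist there is a density operator of $Q_{\rm Ref}$ that gives probability at least $1-\eta$ to each test outcome of which that physicist is certain. - **(G1) No drama:** for Alice, $AB$ is in the Minkowski vacuum $Z^{-1/2}\sum_n e^{-\pi E_n}|n\rangle_A|n\rangle_B$, where $E_n$ are the boost energies in units of the surface gravity. - **(G2) Unitarity:** for Bob, the state of $RR'$ in the asymptotic future is $U|\varphi\rangle$, with $|\varphi\rangle$ a fixed pure initial state and $U$ a Haar-typical unitary. - **(G3) Effective field theory:** for Bob, $R'$ is unitarily related to $H\otimes B$, with $H$ the stretched horizon and $B$ the modes outside it. - **(C) Consistency:** if $P_1$ describes $P_2$ as classical (one orthonormal basis diagonalizes all states that $P_1$ assigns to $P_2$'s memory) and is certain that $P_2$ is certain that a measurement has outcome $x$, then $P_1$ is certain that it has outcome $x$. *Claim.* There is $w>0$, depending only on $\eta$, and for each $\delta>0$ there is $K\ge1$, depending only on $\eta,\delta$, such that the following holds whenever $\dim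 R\ge K\dim R'$ (the black hole is sufficiently older than the Page time). For every $|\varphi\rangle$ and all $U$ outside a set of Haar measure at most $\delta$, for all $A,B,H,Q_{\rm Ref}$ with $|E_m-E_n|\le w$ for all $m,n$ (the vacuum is nearly maximally entangled across the horizon), and in every run: 1. if the strategy is executed and (G1) holds, then for Alice her distilled qubit is maximally entangled with $Q_{\rm Ref}$; 2. if the strategy is executed and (G2), (G3) hold, then for Bob his distilled qubit is maximally entangled with $Q_{\rm Ref}$; 3. under executability, part (i) of (Q), (G1)–(G3) and (C), Alice is certain that her predictions win, whichever test is chosen; 4. executability, (Q), (G1)–(G3) and (C) do not all hold. -/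

import Mathlib

open scoped Matrix Kronecker ComplexOrder

namespace Firewall

noncomputable section

/-! ## Haar measure on the finite-dimensional unitary groups -/

instance unitaryCompact (n : Type) [Fintype n] [DecidableEq n] :
    CompactSpace (Matrix.unitaryGroup n ℂ) := by
  have hc : IsClosed ((Matrix.unitaryGroup n ℂ : Submonoid (Matrix n n ℂ)) :
      Set (Matrix n n ℂ)) := by
    have h : ((Matrix.unitaryGroup n ℂ : Submonoid (Matrix n n ℂ)) : Set (Matrix n n ℂ)) =
        {U | U * star U = 1} := by
      ext U
      exact Matrix.mem_unitaryGroup_iff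
    rw [h]
    exact isClosed_eq (by fun_prop) continuous_const
  have hk : IsCompact (Set.pi Set.univ fun _ : n => Set.pi Set.univ fun _ : n =>
      Metric.closedBall (0 : ℂ) 1) :=
    isCompact_univ_pi fun _ => isCompact_univ_pi fun _ => isCompact_closedBall 0 1
  have hs : ((Matrix.unitaryGroup n ℂ : Submonoid (Matrix n n ℂ)) : Set (Matrix n n ℂ)) ⊆
      (Set.pi Set.univ fun _ : n => Set.pi Set.univ fun _ : n =>
        Metric.closedBall (0 : ℂ) 1) := by
    intro U hU i _ j _
    simpa using entry_norm_bound_of_unitary hU i j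
  exact isCompact_iff_compactSpace.mp (hk.of_isClosed_subset hc hs)

instance unitaryMeasurable (n : Type) [Fintype n] [DecidableEq n] :
    MeasurableSpace (Matrix.unitaryGroup n ℂ) := borel _

instance unitaryBorel (n : Type) [Fintype n] [DecidableEq n] :
    BorelSpace (Matrix.unitaryGroup n ℂ) := ⟨rfl⟩

/-- The Haar probability measure on the unitary group of `ℂⁿ`. -/
def haarUnitary (n : Type) [Fintype n] [DecidableEq n] :
    MeasureTheory.Measure (Matrix.unitaryGroup n ℂ) :=
  MeasureTheory.Measure.haarMeasure ⊤

/-! ## Finite-dimensional quantum theory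

A system with orthonormal basis indexed by a finite type `n` has state space `ℂⁿ`. -/

/-- Density operators. -/
def IsState {n : Type} [Fintype n] (ρ : Matrix n n ℂ) : Prop :=
  ρ.PosSemidef ∧ ρ.trace = 1

/-- `|ψ⟩⟨ψ|`. -/
def pureState {n : Type} (ψ : n → ℂ) : Matrix n n ℂ := Matrix.vecMulVec ψ (star ψ)

/-- Isometries from `ℂⁿ` to `ℂᵐ`. -/
def IsIsometry {m n : Type} [Fintype m] [DecidableEq n] (V : Matrix m n ℂ) : Prop :=
  Vᴴ * V = 1

/-- Unitary maps from `ℂⁿ` to `ℂᵐ` (identifications of two descriptions of one system). -/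
def IsUnitaryMap {m n : Type} [Fintype m] [Fintype n] [DecidableEq m] [DecidableEq n]
    (V : Matrix m n ℂ) : Prop :=
  Vᴴ * V = 1 ∧ V * Vᴴ = 1

/-- A physicist describes a system as classical when one orthonormal basis diagonalizes all the
states that she assigns to it. -/
def IsClassical {n : Type} [Fintype n] [DecidableEq n] (S : Set (Matrix n n ℂ)) : Prop :=
  ∃ U ∈ Matrix.unitaryGroup n ℂ, ∀ ρ ∈ S, (U * ρ * Uᴴ).IsDiag

/-- The two bases in which the referee may measure a qubit. -/
inductive Basis
  | computational
  | diagonal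

/-- The basis vectors `|0⟩, |1⟩` and `(|0⟩ + |1⟩)/√2, (|0⟩ - |1⟩)/√2`. -/
def ket : Basis → Fin 2 → Fin 2 → ℂ
  | .computational, x => fun i => if i = x then 1 else 0
  | .diagonal, x => fun i => ((if i = 1 ∧ x = 1 then -1 else 1) / Real.sqrt 2 : ℝ)

/-- The projector of outcome `x` of the measurement in basis `β`. -/
def proj (β : Basis) (x : Fin 2) : Matrix (Fin 2) (Fin 2) ℂ := pureState (ket β x)

/-- The Born probability of outcome `x` when a qubit in state `ρ` is measured in basis `β`. -/
def born (ρ : Matrix (Fin 2) (Fin 2) ℂ) (β : Basis) (x : Fin 2) : ℝ := (proj β x * ρ).trace.re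

/-- Partial trace over the first factor. -/
def traceFst {m n : Type} [Fintype m] (ρ : Matrix (m × n) (m × n) ℂ) : Matrix n n ℂ :=
  fun i j => ∑ k, ρ (k, i) (k, j)

/-- State update rule: the state of the second qubit after the first one has been measured in
basis `β` with outcome `x`, that is `tr₁((|x⟩⟨x| ⊗ 1) ρ)`, normalized. -/
def update (ρ : Matrix (Fin 2 × Fin 2) (Fin 2 × Fin 2) ℂ) (β : Basis) (x : Fin 2) :
    Matrix (Fin 2) (Fin 2) ℂ :=
  (traceFst ((proj β x ⊗ₖ (1 : Matrix (Fin 2) (Fin 2) ℂ)) * ρ)).trace⁻¹ •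
    traceFst ((proj β x ⊗ₖ (1 : Matrix (Fin 2) (Fin 2) ℂ)) * ρ)

/-- The maximally entangled two-qubit vector `(|0⟩|0⟩ + |1⟩|1⟩)/√2`. -/
def bell : Fin 2 × Fin 2 → ℂ := fun p => if p.1 = p.2 then ((1 / Real.sqrt 2 : ℝ) : ℂ) else 0

/-- The fidelity `⟨Φ|τ|Φ⟩` of a two-qubit state with the maximally entangled state. -/
def bellFidelity (τ : Matrix (Fin 2 × Fin 2) (Fin 2 × Fin 2) ℂ) : ℝ :=
  (star bell ⬝ᵥ (τ *ᵥ bell)).re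

/-- A joint state `ρ` of `S` and `B` is given. The isometry `V` attaches a fresh qubit to `S` and
sets apart a qubit; the unitary `W` displays a qubit as a tensor factor of `B`. The
result is the joint state of these two qubits (the qubit from `S` comes first). -/
def qubitPair {S B b : Type} [Fintype S] [Fintype B] [Fintype b]
    (V : Matrix (Fin 2 × S) S ℂ) (W : Matrix (Fin 2 × b) B ℂ)
    (ρ : Matrix (S × B) (S × B) ℂ) : Matrix (Fin 2 × Fin 2) (Fin 2 × Fin 2) ℂ :=
  fun p q => ∑ s, ∑ k,
    ((V ⊗ₖ W) * ρ * (V ⊗ₖ W)ᴴ) ((p.1, s), (p.2, k)) ((q.1, s), (q.2, k))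

/-- `V` carries out the instruction to distil from `S`, up to infidelity `ε`, a qubit maximally
entangled with the qubit located by `W`: it succeeds if any isometry does. -/
def Distils {S B b : Type} [Fintype S] [DecidableEq S] [Fintype B] [Fintype b] (ε : ℝ)
    (W : Matrix (Fin 2 × b) B ℂ) (ρ : Matrix (S × B) (S × B) ℂ)
    (V : Matrix (Fin 2 × S) S ℂ) : Prop :=
  IsIsometry V ∧
    ((∃ V' : Matrix (Fin 2 × S) S ℂ, IsIsometry V' ∧ 1 - ε ≤ bellFidelity (qubitPair V' W ρ)) →
      1 - ε ≤ bellFidelity (qubitPair V W ρ))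

/-! ## The complementarity game -/

/-- A quantum strategy: `σ p q` is the subnormalized state of the indicated qubit on the event
that the physicists issue the predictions `(p, q)`. -/
def IsStrategy (σ : Fin 2 → Fin 2 → Matrix (Fin 2) (Fin 2) ℂ) : Prop :=
  (∀ p q, (σ p q).PosSemidef) ∧ ∑ p, ∑ q, (σ p q).trace = 1

/-- The probability that the referee's test, chosen by a fair coin, succeeds. -/
def winProb (σ : Fin 2 → Fin 2 → Matrix (Fin 2) (Fin 2) ℂ) : ℝ :=
  ∑ p, ∑ q, (1 / 2 * born (σ p q) .computational p + 1 / 2 * born (σ p q) .diagonal q)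

/-! ## Physicists and what they are certain of -/

/-- Alice falls freely into the black hole; Bob stays outside. -/
inductive Physicist
  | alice
  | bob

/-- Alice measures her distilled qubit in the computational basis, Bob in the diagonal basis. -/
def ownBasis : Physicist → Basis
  | .alice => .computational
  | .bob => .diagonal

/-- The measurements that claims are about: the one that a physicist performs on the qubit he or
she has distilled, and the two possible tests of the referee. -/
inductive Measurement
  | own (P : Physicist)
  | test (β : Basis)

/-- Claims that a physicist may be certain of. -/
inductive Claim
  | outcome (M : Measurement) (x : Fin 2)
  | certain (P : Physicist) (c : Claim)

/-! ## The black hole -/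

/-- The field modes near the horizon and the referee's qubit. `A` and `B` index occupation bases
of the modes just inside and just outside the horizon. -/
structure Horizon (A B b : Type) [Fintype B] [Fintype b] [DecidableEq B] [DecidableEq b] where
  /-- The partner inside of a configuration outside. -/
  partner : B ≃ A
  /-- Boost energy of a configuration, in units of the surface gravity. -/
  energy : B → ℝ
  /-- Displays the referee's qubit as a tensor factor of the modes `B`. -/
  refQubit : Matrix (Fin 2 × b) B ℂ
  refQubit_unitary : IsUnitaryMap refQubit

/-- The Minkowski vacuum of the modes on both sides of the horizon, in its thermofield form
`Z^(-1/2) ∑ₙ exp(-π Eₙ) |n⟩_A |n⟩_B` (its restriction to either side is the thermal state of the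
boost energy at the Unruh temperature `1/(2π)`). -/
def vacuum {A B b : Type} [Fintype B] [Fintype b] [DecidableEq A] [DecidableEq B] [DecidableEq b]
    (G : Horizon A B b) : A × B → ℂ := fun p =>
  if p.1 = G.partner p.2 then
    ((Real.exp (-Real.pi * G.energy p.2) /
      Real.sqrt (∑ n, Real.exp (-2 * Real.pi * G.energy n)) : ℝ) : ℂ)
  else 0

/-- Everything that may differ from one run to another. None of the assumptions is built in. The
systems are: `A` and `B` as above, the collected early radiation `R`, the late radiation `R'`, and
the degrees of freedom `H` of the stretched horizon. -/
structure Run (R R' A B H : Type) where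
  /-- The state that Alice assigns to the modes across the horizon. -/
  aliceState : Matrix (A × B) (A × B) ℂ
  /-- The state that Bob assigns to the radiation in the asymptotic future. -/
  bobFuture : Matrix (R × R') (R × R') ℂ
  /-- The state that Bob assigns to the early radiation, the stretched horizon and the zone. -/
  bobPresent : Matrix (R × (H × B)) (R × (H × B)) ℂ
  /-- Alice's distillation operation. -/
  aliceDistil : Matrix (Fin 2 × A) A ℂ
  /-- Bob's distillation operation. -/
  bobDistil : Matrix (Fin 2 × R) R ℂ
  /-- The outcomes that the physicists record. -/
  record : Physicist → Fin 2
  /-- What Alice reads in the register that Bob has sent. -/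
  received : Fin 2
  /-- The pair of predictions issued to the referee. -/
  prediction : Fin 2 × Fin 2
  /-- `memory P₁ P₂`: the states that `P₁` assigns to the memory of `P₂`. -/
  memory : Physicist → Physicist → Set (Matrix (Fin 2) (Fin 2) ℂ)
  /-- What each physicist is certain of. -/
  certain : Physicist → Claim → Prop

section Assumptions

variable {R R' A B H b : Type} [Fintype R] [Fintype R'] [Fintype A] [Fintype B] [Fintype H]
  [Fintype b] [DecidableEq R] [DecidableEq R'] [DecidableEq A] [DecidableEq B] [DecidableEq H]
  [DecidableEq b]

/-- Bob's state of the early radiation and the zone. -/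
def bobReduced (r : Run R R' A B H) : Matrix (R × B) (R × B) ℂ :=
  fun p q => ∑ h, r.bobPresent (p.1, (h, p.2)) (q.1, (h, q.2))

/-- The joint state of the distilled qubit and the referee's qubit, as described by the physicist
who has distilled. -/
def pairState (G : Horizon A B b) (r : Run R R' A B H) :
    Physicist → Matrix (Fin 2 × Fin 2) (Fin 2 × Fin 2) ℂ
  | .alice => qubitPair r.aliceDistil G.refQubit r.aliceState
  | .bob => qubitPair r.bobDistil G.refQubit (bobReduced r)

/-- From outcome `x` of the measurement of `P`, quantum theory predicts outcome `y` for the test in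
basis `β`, up to probability `η`. -/
def Predicts (η : ℝ) (G : Horizon A B b) (r : Run R R' A B H) (P : Physicist) (x : Fin 2)
    (β : Basis) (y : Fin 2) : Prop :=
  1 - η ≤ born (update (pairState G r P) (ownBasis P) x) β y

/-- Executability: the firewall strategy is executed. -/
structure Executed (η : ℝ) (G : Horizon A B b) (r : Run R R' A B H) : Prop where
  alice_distils : Distils (η / 4) G.refQubit r.aliceState r.aliceDistil
  alice_records : r.certain .alice (.outcome (.own .alice) (r.record .alice))
  bob_distils : Distils (η / 4) G.refQubit (bobReduced r) r.bobDistil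
  bob_records : r.certain .bob (.outcome (.own .bob) (r.record .bob))
  /-- Alice receives the register in which Bob has recorded his outcome. -/
  bob_sends : r.received = r.record .bob
  /-- The register is a classical record for Alice; after reading it she assigns to it the state
  of the value that she has read. -/
  bob_classical : ∀ ρ ∈ r.memory .alice .bob, ρ.IsDiag
  alice_reads : proj .computational r.received ∈ r.memory .alice .bob ∧
    r.certain .alice (.certain .bob (.outcome (.own .bob) r.received))
  alice_predicts : r.prediction = (r.record .alice, r.received)

/-- Every physicist can reason with quantum theory: states are density operators, and from the
outcome of his or her own measurement, a physicist infers with the state update rule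
and the Born rule the outcomes of the tests. A physicist can also use the theory to describe another
physicist who uses the theory in this way. -/
structure QuantumReasoning (η : ℝ) (G : Horizon A B b) (r : Run R R' A B H) : Prop where
  alice_state : IsState r.aliceState
  bob_future_state : IsState r.bobFuture
  bob_present_state : IsState r.bobPresent
  own : ∀ P x β y, r.certain P (.outcome (.own P) x) → Predicts η G r P x β y →
    r.certain P (.outcome (.test β) y)
  simulate : ∀ P₁ P₂ x β y, r.certain P₁ (.certain P₂ (.outcome (.own P₂) x)) →
    Predicts η G r P₂ x β y → r.certain P₁ (.certain P₂ (.outcome (.test β) y))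

/-- Quantum theory describes the tests of the referee: for every physicist there is a quantum
state of the referee's qubit that gives, up to `η`, probability one to the test outcomes that the
physicist is certain of. -/
def QuantumTests (η : ℝ) (r : Run R R' A B H) : Prop :=
  ∀ P, ∃ ρ : Matrix (Fin 2) (Fin 2) ℂ, IsState ρ ∧
    ∀ β y, r.certain P (.outcome (.test β) y) → 1 - η ≤ born ρ β y

/-- Universality: any physicist can apply quantum theory to any system. -/
def UniversalQuantumTheory (η : ℝ) (G : Horizon A B b) (r : Run R R' A B H) : Prop :=
  QuantumReasoning η G r ∧ QuantumTests η r

/-- No drama: for the freely falling physicist, the fields at the horizon are in the Minkowski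
vacuum. -/
def NoDrama (G : Horizon A B b) (r : Run R R' A B H) : Prop :=
  r.aliceState = pureState (vacuum G)

/-- Unitarity: for the outside physicist, the black hole and all fields, created in the pure state
`φ`, have evolved by the unitary `U` into the radiation of the asymptotic future. -/
def UnitaryEvaporation (φ : R × R' → ℂ) (U : Matrix.unitaryGroup (R × R') ℂ)
    (r : Run R R' A B H) : Prop :=
  r.bobFuture = pureState ((U : Matrix (R × R') (R × R') ℂ) *ᵥ φ)

/-- Effective field theory: for the outside physicist, what becomes the late radiation consists at
present of the stretched horizon and, outside it, the field modes in the zone. The early radiation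
is stored; the rest is related to its asymptotic future by a unitary evolution. -/
def EffectiveFieldTheory (r : Run R R' A B H) : Prop :=
  ∃ V : Matrix (H × B) R' ℂ, IsUnitaryMap V ∧
    r.bobPresent = ((1 : Matrix R R ℂ) ⊗ₖ V) * r.bobFuture * ((1 : Matrix R R ℂ) ⊗ₖ V)ᴴ

/-- Consistency of knowledge. -/
def Consistency (r : Run R R' A B H) : Prop :=
  ∀ P₁ P₂, P₁ ≠ P₂ → IsClassical (r.memory P₁ P₂) → ∀ M x,
    r.certain P₁ (.certain P₂ (.outcome M x)) → r.certain P₁ (.outcome M x)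

/-- Alice is certain that the issued predictions win, whichever test the referee chooses. -/
def CertainToWin (r : Run R R' A B H) : Prop :=
  r.certain .alice (.outcome (.test .computational) r.prediction.1) ∧
    r.certain .alice (.outcome (.test .diagonal) r.prediction.2)

/-- The firewall paradox for one initial state and one evolution of the black hole, with modes `B`
at the horizon whose boost energies agree up to `w`. -/
def Paradox (η w : ℝ) (φ : R × R' → ℂ) (U : Matrix.unitaryGroup (R × R') ℂ) : Prop :=
  ∀ (A B H b : Type) [Fintype A] [Fintype B] [Fintype H] [Fintype b]
    [DecidableEq A] [DecidableEq B] [DecidableEq H] [DecidableEq b] [Nonempty B]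
    (G : Horizon A B b), (∀ m n, |G.energy m - G.energy n| ≤ w) →
    ∀ r : Run R R' A B H,
      (Executed η G r → NoDrama G r →
        1 - η / 4 ≤ bellFidelity (pairState G r .alice)) ∧
      (Executed η G r → UnitaryEvaporation φ U r → EffectiveFieldTheory r →
        1 - η / 4 ≤ bellFidelity (pairState G r .bob)) ∧
      (Executed η G r → QuantumReasoning η G r → NoDrama G r → UnitaryEvaporation φ U r →
        EffectiveFieldTheory r → Consistency r → CertainToWin r) ∧
      ¬ (Executed η G r ∧ UniversalQuantumTheory η G r ∧
          (NoDrama G r ∧ UnitaryEvaporation φ U r ∧ EffectiveFieldTheory r) ∧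
          Consistency r)

end Assumptions

end

end Firewall

/-!
The bound on the game is an uncertainty relation: for a positive `2 × 2` matrix the probabilities of
one computational and one diagonal outcome add up to at most `1 + 1/√2` (`born_add_born_le`). No
quantum state can therefore make two such outcomes almost certain, and the paradox consists in
leading Alice to be certain of both.

A pair of qubits with fidelity at least `1 - η/4` to the maximally entangled state has, in each of
the two bases, nearly perfectly correlated outcomes, also conditionally on either outcome
(`le_born_update`). So it is enough that Alice and Bob can both distil such a pair. Then Alice infers
the computational outcome herself, and the diagonal one from Bob (`certainToWin`).

Both distillations come from one construction (`exists_distillation`): if the joint vector of `S` and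
`H ⊗ B` overlaps well with the normalized maximally entangled vector of an isometry `H ⊗ B → S`, then
undoing this isometry on `S` delivers a qubit entangled with any prescribed qubit of `B`.
For Alice, `H` is trivial, and the vacuum is close to the maximally entangled vector because its
amplitudes are nearly equal (`exp_le_sq_sum_amplitude`). For Bob, the isometry is the one in the polar
decomposition of the matrix of amplitudes of the radiation; the overlap is the sum of the singular
values, which is nearly maximal if the purity of the late radiation is nearly minimal
(`exists_isometry_overlap`). Purity does not depend on the decomposition of the late radiation into
stretched horizon and zone, so the exceptional set of evolutions does not depend on it either.

The average purity of the late radiation is `(dim R + dim R') / (dim R dim R' + 1)`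
(`integral_purity`), computed from the second moments of a Haar-random unit vector, and Markov's
inequality bounds the exceptional set (`haarUnitary_purity_le`).
-/

namespace Firewall

/-! ### The complementarity game -/

theorem posSemidef_fin_two_offDiag {σ : Matrix (Fin 2) (Fin 2) ℂ} (hσ : σ.PosSemidef) :
    0 ≤ (σ 0 0).re ∧ 0 ≤ (σ 1 1).re ∧ (σ 1 0).re = (σ 0 1).re ∧
      (σ 0 1).re ^ 2 ≤ (σ 0 0).re * (σ 1 1).re := by
  have h0 := (Complex.nonneg_iff.mp (hσ.diag_nonneg (i := 0)))
  have h1 := (Complex.nonneg_iff.mp (hσ.diag_nonneg (i := 1)))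
  have h10 : σ 1 0 = star (σ 0 1) := (hσ.isHermitian.apply 1 0).symm
  have hd := (Complex.nonneg_iff.mp hσ.det_nonneg).1
  rw [Matrix.det_fin_two, h10] at hd
  simp at hd
  refine ⟨h0.1, h1.1, by simp [h10], ?_⟩
  rw [← h0.2, ← h1.2] at hd
  nlinarith [sq_nonneg (σ 0 1).im]

theorem born_computational (σ : Matrix (Fin 2) (Fin 2) ℂ) (p : Fin 2) :
    born σ .computational p = (σ p p).re := by
  fin_cases p <;>
    simp [born, proj, pureState, ket, Matrix.trace, Matrix.mul_apply, Matrix.vecMulVec_apply]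

theorem ofReal_sqrt_two_sq : ((Real.sqrt 2 : ℝ) : ℂ) ^ 2 = 2 := by
  rw [← Complex.ofReal_pow, Real.sq_sqrt (by norm_num)]; norm_num

theorem born_diagonal (σ : Matrix (Fin 2) (Fin 2) ℂ) (q : Fin 2) :
    born σ .diagonal q = ((σ 0 0).re + (σ 1 1).re) / 2 +
      (if q = 0 then 1 else -1) * ((σ 0 1).re + (σ 1 0).re) / 2 := by
  have hs : Real.sqrt 2 ^ 2 = 2 := Real.sq_sqrt (by norm_num)
  fin_cases q <;>
    simp [born, proj, pureState, ket, Matrix.trace, Matrix.mul_apply, Matrix.vecMulVec_apply,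
      Fin.sum_univ_two, neg_div] <;> ring_nf <;> rw [hs] <;> ring

/-- The uncertainty relation for the two tests: the projectors onto a computational and a diagonal
basis vector add up to at most `1 + 1/√2`, written here as `1 + 2/√8`. -/
theorem born_add_born_le {σ : Matrix (Fin 2) (Fin 2) ℂ} (hσ : σ.PosSemidef) (p q : Fin 2) :
    born σ .computational p + born σ .diagonal q ≤ (1 + 2 / Real.sqrt 8) * σ.trace.re := by
  obtain ⟨h0, h1, h10, hd⟩ := posSemidef_fin_two_offDiag hσ
  have h8 : 2 / Real.sqrt 8 = Real.sqrt 2 / 2 := by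
    have : Real.sqrt 8 = 2 * Real.sqrt 2 := by
      rw [show (8 : ℝ) = 2 ^ 2 * 2 by norm_num, Real.sqrt_mul (by norm_num),
        Real.sqrt_sq (by norm_num)]
    rw [this]
    have := Real.mul_self_sqrt (show (0:ℝ) ≤ 2 by norm_num)
    have hp : 0 < Real.sqrt 2 := by positivity
    field_simp
    nlinarith
  have key : ∀ e c : ℝ, e ^ 2 = ((σ 0 0).re - (σ 1 1).re) ^ 2 → c ^ 2 = (σ 0 1).re ^ 2 →
      e / 2 + c ≤ Real.sqrt 2 / 2 * ((σ 0 0).re + (σ 1 1).re) := by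
    intro e c he hc
    -- `(e/2 + c)² ≤ 2 (e²/4 + c²)`, and `c² ≤ σ₀₀ σ₁₁`
    refine le_of_abs_le (abs_le_of_sq_le_sq ?_ (by positivity))
    have := Real.sq_sqrt (show (0:ℝ) ≤ 2 by norm_num)
    rw [mul_pow, div_pow, this]
    nlinarith [sq_nonneg (e / 2 - c)]
  rw [born_computational, born_diagonal, h8, Matrix.trace_fin_two, Complex.add_re, h10]
  have hc : ((if q = 0 then (1 : ℝ) else -1) * (σ 0 1).re) ^ 2 = (σ 0 1).re ^ 2 := by
    split_ifs <;> ring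
  fin_cases p
  · have := key ((σ 0 0).re - (σ 1 1).re) _ rfl hc
    simp only [Fin.zero_eta] at *
    linarith
  · have := key ((σ 1 1).re - (σ 0 0).re) _ (by ring) hc
    simp only [Fin.mk_one] at *
    linarith

theorem winProb_le {σ : Fin 2 → Fin 2 → Matrix (Fin 2) (Fin 2) ℂ} (hσ : IsStrategy σ) :
    winProb σ ≤ 1 / 2 + 1 / Real.sqrt 8 := by
  have htr : ∑ p, ∑ q, (σ p q).trace.re = 1 := by
    have := congrArg Complex.re hσ.2
    simpa only [Complex.re_sum, Complex.one_re] using this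
  calc winProb σ
      ≤ ∑ p, ∑ q, (1 / 2 + 1 / Real.sqrt 8) * (σ p q).trace.re := by
        refine Finset.sum_le_sum fun p _ => Finset.sum_le_sum fun q _ => ?_
        linear_combination (1 / 2 : ℝ) * born_add_born_le (hσ.1 p q) p q
    _ = 1 / 2 + 1 / Real.sqrt 8 := by
        simp only [← Finset.mul_sum]
        rw [htr, mul_one]

/-! ### Correlations of nearly maximally entangled qubits -/

/-- The product vector `|x⟩|y⟩` of two vectors of the basis `β`. -/
noncomputable def pairKet (β : Basis) (x y : Fin 2) : Fin 2 × Fin 2 → ℂ := fun p =>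
  ket β x p.1 * ket β y p.2

/-- The joint probability of the outcomes `x` and `y`, via the unnormalized updated state. -/
theorem trace_proj_mul_traceFst (τ : Matrix (Fin 2 × Fin 2) (Fin 2 × Fin 2) ℂ) (β : Basis)
    (x y : Fin 2) :
    (proj β y * traceFst ((proj β x ⊗ₖ (1 : Matrix (Fin 2) (Fin 2) ℂ)) * τ)).trace =
      star (pairKet β x y) ⬝ᵥ (τ *ᵥ pairKet β x y) := by
  simp [proj, pureState, traceFst, Matrix.trace, Matrix.mul_apply, Matrix.vecMulVec_apply,
    Fin.sum_univ_two, Fintype.sum_prod_type, Matrix.mulVec, dotProduct, pairKet]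
  ring

theorem sum_proj (β : Basis) : proj β 0 + proj β 1 = 1 := by
  have hs : ((Real.sqrt 2 : ℝ) : ℂ)⁻¹ * ((Real.sqrt 2 : ℝ) : ℂ)⁻¹ = 1 / 2 := by
    rw [← mul_inv, ← sq, ofReal_sqrt_two_sq]; norm_num
  cases β <;> ext i j <;> fin_cases i <;> fin_cases j <;>
    simp [proj, pureState, ket, Matrix.vecMulVec_apply, hs, neg_div] <;> norm_num

/-- The maximally entangled vector has the same form in both bases. -/
theorem bell_eq (β : Basis) :
    bell = ((1 / Real.sqrt 2 : ℝ) : ℂ) • (pairKet β 0 0 + pairKet β 1 1) := by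
  have hs : ((Real.sqrt 2 : ℝ) : ℂ)⁻¹ * ((Real.sqrt 2 : ℝ) : ℂ)⁻¹ = 1 / 2 := by
    rw [← mul_inv, ← sq, ofReal_sqrt_two_sq]; norm_num
  cases β <;> ext ⟨i, j⟩ <;> fin_cases i <;> fin_cases j <;>
    simp [bell, pairKet, ket, hs, neg_div] <;> norm_num

/-- A qubit pair close to the maximally entangled state has nearly perfect correlations in each of
the two bases, and neither outcome is rare enough to spoil the conditional probability. -/
theorem le_born_update {τ : Matrix (Fin 2 × Fin 2) (Fin 2 × Fin 2) ℂ} (hτ : IsState τ) {η : ℝ}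
    (hη : η ≤ 1 / 4) (hF : 1 - η / 4 ≤ bellFidelity τ) (β : Basis) (x : Fin 2) :
    1 - η ≤ born (update τ β x) β x := by
  set N : Fin 2 → Matrix (Fin 2) (Fin 2) ℂ := fun x =>
    traceFst ((proj β x ⊗ₖ (1 : Matrix (Fin 2) (Fin 2) ℂ)) * τ) with hN
  set P : Fin 2 → Fin 2 → ℝ := fun x y =>
    (star (pairKet β x y) ⬝ᵥ (τ *ᵥ pairKet β x y)).re with hP
  have hP0 : ∀ x y, 0 ≤ P x y := fun x y =>
    (Complex.nonneg_iff.mp (hτ.1.dotProduct_mulVec_nonneg _)).1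
  have hPN : ∀ x y, (proj β y * N x).trace = (P x y : ℂ) := by
    intro x y
    rw [hN, trace_proj_mul_traceFst]
    have := (Complex.nonneg_iff.mp (hτ.1.dotProduct_mulVec_nonneg (pairKet β x y))).2
    apply Complex.ext
    · simp [hP]
    · simpa using this.symm
  have htrN : ∀ x, (N x).trace = ((P x 0 + P x 1 : ℝ) : ℂ) := by
    intro x
    rw [Complex.ofReal_add, ← hPN, ← hPN, ← Matrix.trace_add, ← add_mul, sum_proj, one_mul]
  have hsum : P 0 0 + P 0 1 + (P 1 0 + P 1 1) = 1 := by
    have h : N 0 + N 1 = traceFst τ := by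
      ext i j
      have hs : ∀ k l, proj β 0 k l + proj β 1 k l = (1 : Matrix (Fin 2) (Fin 2) ℂ) k l :=
        fun k l => by rw [← sum_proj β]; rfl
      have h00 := hs 0 0
      have h01 := hs 0 1
      have h10 := hs 1 0
      have h11 := hs 1 1
      simp at h00 h01 h10 h11
      fin_cases i <;> fin_cases j <;>
      simp [hN, traceFst, Matrix.mul_apply, Fintype.sum_prod_type, Fin.sum_univ_two] <;>
      grind
    have h2 : (traceFst τ).trace = 1 := by
      rw [← hτ.2]
      simp [Matrix.trace, traceFst, Fintype.sum_prod_type, Fin.sum_univ_two]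
      ring
    rw [← h, Matrix.trace_add, htrN, htrN] at h2
    exact_mod_cast h2
  have hupd : born (update τ β x) β x = P x x / (P x 0 + P x 1) := by
    have : born (update τ β x) β x = ((N x).trace⁻¹ * (proj β x * N x).trace).re := by
      rw [born, update, Matrix.mul_smul, Matrix.trace_smul, smul_eq_mul]
    rw [this, htrN, hPN, ← Complex.ofReal_inv, ← Complex.ofReal_mul, Complex.ofReal_re]
    ring
  have hs : ((Real.sqrt 2 : ℝ) : ℂ)⁻¹ * ((Real.sqrt 2 : ℝ) : ℂ)⁻¹ = 1 / 2 := by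
    rw [← mul_inv, ← sq, ofReal_sqrt_two_sq]; norm_num
  set u := pairKet β 0 0 with hu
  set v := pairKet β 1 1 with hv
  have hFid : bellFidelity τ = (star (u + v) ⬝ᵥ (τ *ᵥ (u + v))).re / 2 := by
    rw [bellFidelity, bell_eq β, star_smul, smul_dotProduct, Matrix.mulVec_smul, dotProduct_smul,
      smul_smul]
    have : (star (((1 / Real.sqrt 2 : ℝ) : ℂ)) * ((1 / Real.sqrt 2 : ℝ) : ℂ)) = ((1 / 2 : ℝ) : ℂ) := by
      simp [hs]
    rw [this, smul_eq_mul, Complex.re_ofReal_mul]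
    ring
  have nn : ∀ z, 0 ≤ (star z ⬝ᵥ (τ *ᵥ z)).re := fun z =>
    (Complex.nonneg_iff.mp (hτ.1.dotProduct_mulVec_nonneg z)).1
  -- Positivity at `u - v` bounds the mismatch probability by `η / 4`. Positivity at `2u - v` and
  -- `u - 2v`, where `6 P(u) + 3 P(v) ≥ 4 F`, bounds the probability of either outcome away from zero.
  have h1 := nn (u - v)
  have h2 := nn ((2 : ℂ) • u - v)
  have h3 := nn (u - (2 : ℂ) • v)
  have e0 : P 0 0 = (star u ⬝ᵥ (τ *ᵥ u)).re := rfl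
  have e1 : P 1 1 = (star v ⬝ᵥ (τ *ᵥ v)).re := rfl
  simp [Matrix.mulVec_add, Matrix.mulVec_sub, Matrix.mulVec_smul] at hFid h1 h2 h3
  rw [← e0, ← e1] at hFid h1 h2 h3
  rw [hupd]
  have a00 := hP0 0 0
  have a01 := hP0 0 1
  have a10 := hP0 1 0
  have a11 := hP0 1 1
  fin_cases x
  · simp only [Fin.zero_eta]
    rw [le_div_iff₀ (by linarith)]
    nlinarith
  · simp only [Fin.mk_one]
    rw [le_div_iff₀ (by linarith)]
    nlinarith

/-! ### Distillation of entangled qubits -/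

/-- Vectors `v i`, `i ∈ s`, that are orthonormal are columns of a unitary matrix. -/
theorem exists_unitary_extending_columns {n : Type} [Fintype n] [DecidableEq n] (s : Set n)
    (v : n → n → ℂ)
    (hv : ∀ i ∈ s, ∀ j ∈ s, ∑ k, star (v i k) * v j k = if i = j then 1 else 0) :
    ∃ Q : Matrix n n ℂ, Qᴴ * Q = 1 ∧ ∀ i ∈ s, ∀ k, Q k i = v i k := by
  have hon : Orthonormal ℂ (s.domRestrict fun i => WithLp.toLp 2 (v i)) := by
    rw [orthonormal_iff_ite]
    rintro ⟨i, hi⟩ ⟨j, hj⟩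
    have := hv i hi j hj
    simp only [Set.domRestrict_apply, Subtype.mk.injEq, EuclideanSpace.inner_eq_star_dotProduct,
      dotProduct, Pi.star_apply]
    rw [← this]
    exact Finset.sum_congr rfl fun k _ => mul_comm _ _
  obtain ⟨e, he⟩ := hon.exists_orthonormalBasis_extension_of_card_eq (by simp)
  have hQ : (Matrix.of fun k i => e i k)ᴴ * (Matrix.of fun k i => e i k) = 1 := by
    ext i j
    have := orthonormal_iff_ite.mp e.orthonormal i j
    rw [EuclideanSpace.inner_eq_star_dotProduct] at this
    rw [Matrix.one_apply, ← this]
    simp [Matrix.mul_apply, dotProduct, mul_comm]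
  refine ⟨_, hQ, fun i hi k => ?_⟩
  simp [he i hi]

theorem isState_qubitPair {S B b : Type} [Fintype S] [DecidableEq S] [Fintype B] [DecidableEq B]
    [Fintype b] {V : Matrix (Fin 2 × S) S ℂ} {W : Matrix (Fin 2 × b) B ℂ}
    {ρ : Matrix (S × B) (S × B) ℂ} (hV : IsIsometry V) (hW : Wᴴ * W = 1) (hρ : IsState ρ) :
    IsState (qubitPair V W ρ) := by
  have hT : (V ⊗ₖ W)ᴴ * (V ⊗ₖ W) = 1 := by
    rw [Matrix.conjTranspose_kronecker, ← Matrix.mul_kronecker_mul, hV, hW,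
      Matrix.one_kronecker_one]
  constructor
  · have : qubitPair V W ρ = ∑ s, ∑ k, ((V ⊗ₖ W) * ρ * (V ⊗ₖ W)ᴴ).submatrix
        (fun p : Fin 2 × Fin 2 => ((p.1, s), (p.2, k))) (fun p => ((p.1, s), (p.2, k))) := by
      ext p q
      simp only [qubitPair, Matrix.sum_apply, Matrix.submatrix_apply]
    rw [this]
    exact Matrix.posSemidef_sum _ fun s _ => Matrix.posSemidef_sum _ fun k _ =>
      (hρ.1.mul_mul_conjTranspose_same _).submatrix _
  · have : (qubitPair V W ρ).trace = ((V ⊗ₖ W) * ρ * (V ⊗ₖ W)ᴴ).trace := by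
      simp only [Matrix.trace, Matrix.diag_apply, qubitPair, Fintype.sum_prod_type]
      refine Finset.sum_congr rfl fun p _ => ?_
      rw [Finset.sum_comm]
    rw [this, Matrix.trace_mul_comm, ← Matrix.mul_assoc, hT, Matrix.one_mul, hρ.2]

theorem isState_bobReduced {R R' A B H : Type} [Fintype R] [Fintype B] [Fintype H]
    {r : Run R R' A B H} (h : IsState r.bobPresent) : IsState (bobReduced r) := by
  constructor
  · have : bobReduced r = ∑ h, r.bobPresent.submatrix
        (fun p : R × B => (p.1, (h, p.2))) (fun p => (p.1, (h, p.2))) := by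
      ext p q
      simp only [bobReduced, Matrix.sum_apply, Matrix.submatrix_apply]
    rw [this]
    exact Matrix.posSemidef_sum _ fun _ _ => h.1.submatrix _
  · rw [← h.2]
    simp only [Matrix.trace, Matrix.diag_apply, bobReduced, Fintype.sum_prod_type]
    refine Finset.sum_congr rfl fun p _ => ?_
    rw [Finset.sum_comm]

theorem mul_pureState_mul_conjTranspose {m n : Type} [Fintype n] (M : Matrix m n ℂ) (ψ : n → ℂ) :
    M * pureState ψ * Mᴴ = pureState (M *ᵥ ψ) := by
  rw [pureState, Matrix.mul_vecMulVec, Matrix.vecMulVec_mul, pureState, Matrix.star_mulVec]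

theorem bellFidelity_eq (τ : Matrix (Fin 2 × Fin 2) (Fin 2 × Fin 2) ℂ) :
    bellFidelity τ = (τ (0, 0) (0, 0) + τ (0, 0) (1, 1) + τ (1, 1) (0, 0) +
      τ (1, 1) (1, 1)).re / 2 := by
  have hs : Real.sqrt 2 ^ 2 = 2 := Real.sq_sqrt (by norm_num)
  have hp : Real.sqrt 2 ≠ 0 := by positivity
  simp [bellFidelity, bell, dotProduct, Matrix.mulVec, Fintype.sum_prod_type]
  field_simp
  rw [hs]
  ring

/-- The fidelity of the distilled pair, for a state given by a purification with components `Ψ h`. -/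
theorem bellFidelity_qubitPair {S B b H : Type} [Fintype S] [Fintype B] [Fintype b] [Fintype H]
    (V : Matrix (Fin 2 × S) S ℂ) (W : Matrix (Fin 2 × b) B ℂ) (Ψ : H → S × B → ℂ) :
    bellFidelity (qubitPair V W (∑ h, pureState (Ψ h))) =
      ∑ h, ∑ s, ∑ k, ‖∑ p : Fin 2, ((V ⊗ₖ W) *ᵥ Ψ h) ((p, s), (p, k))‖ ^ 2 / 2 := by
  simp only [bellFidelity_eq, qubitPair, Matrix.mul_sum, Matrix.sum_mul,
    mul_pureState_mul_conjTranspose, ← Finset.sum_add_distrib]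
  simp only [Matrix.sum_apply, ← Finset.sum_add_distrib, Complex.re_sum, Finset.sum_div]
  rw [Finset.sum_congr rfl fun s _ => Finset.sum_comm, Finset.sum_comm]
  refine Finset.sum_congr rfl fun h _ => Finset.sum_congr rfl fun s _ =>
    Finset.sum_congr rfl fun k _ => ?_
  rw [← Complex.normSq_eq_norm_sq]
  simp [pureState, Matrix.vecMulVec_apply, Complex.normSq_apply]
  ring

theorem card_eq_of_isUnitaryMap {m n : Type} [Fintype m] [Fintype n] [DecidableEq m]
    [DecidableEq n] {V : Matrix m n ℂ} (hV : IsUnitaryMap V) :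
    Fintype.card m = Fintype.card n := by
  have h := Matrix.trace_mul_comm V Vᴴ
  rw [hV.1, hV.2, Matrix.trace_one, Matrix.trace_one] at h
  exact_mod_cast h

theorem norm_sum_sq_le_card_mul {ι : Type} [Fintype ι] (z : ι → ℂ) :
    ‖∑ i, z i‖ ^ 2 ≤ Fintype.card ι * ∑ i, ‖z i‖ ^ 2 :=
  calc ‖∑ i, z i‖ ^ 2 ≤ (∑ i, ‖z i‖) ^ 2 := by gcongr; exact norm_sum_le _ _
    _ ≤ _ := by simpa using sq_sum_le_card_mul_sum_sq (s := Finset.univ) (f := fun i => ‖z i‖)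

/-- If the joint vector `Ψ` of `S` and `H ⊗ B` overlaps with the normalized maximally entangled
vector given by the isometry `X`, then a qubit entangled with the qubit in `B` can be distilled from
`S` with at least the corresponding fidelity, uniformly in the choice of that qubit. The distilling
isometry undoes `X`; the factor `H` and the rest of `B` are purified by the remainder of `S`. -/
theorem exists_distillation {S H B b : Type} [Fintype S] [DecidableEq S] [Fintype H]
    [DecidableEq H] [Fintype B] [DecidableEq B] [Fintype b] [DecidableEq b]
    {W : Matrix (Fin 2 × b) B ℂ} (hW : IsUnitaryMap W) {X : Matrix S (H × B) ℂ}
    (hX : Xᴴ * X = 1) (hcard : Fintype.card (H × B) ≤ Fintype.card S) (Ψ : S × (H × B) → ℂ) :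
    ∃ V : Matrix (Fin 2 × S) S ℂ, IsIsometry V ∧
      ‖∑ r, ∑ c, star (X r c) * Ψ (r, c)‖ ^ 2 / Fintype.card (H × B) ≤
        bellFidelity (qubitPair V W (∑ h, pureState fun p : S × B => Ψ (p.1, (h, p.2)))) := by
  -- `Y` is `X` expressed in the product basis of `H`, the located qubit and the rest of `B`.
  set T : Matrix (H × (Fin 2 × b)) (H × B) ℂ := (1 : Matrix H H ℂ) ⊗ₖ W with hT
  have hTu : Tᴴ * T = 1 ∧ T * Tᴴ = 1 := by
    constructor <;>
      rw [hT, Matrix.conjTranspose_kronecker, ← Matrix.mul_kronecker_mul,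
        Matrix.conjTranspose_one, Matrix.one_mul]
    · rw [hW.1, Matrix.one_kronecker_one]
    · rw [hW.2, Matrix.one_kronecker_one]
  set Y : Matrix S (H × (Fin 2 × b)) ℂ := X * Tᵀ with hY
  have hYY : Yᴴ * Y = 1 := by
    rw [hY, Matrix.conjTranspose_mul, Matrix.mul_assoc, ← Matrix.mul_assoc Xᴴ, hX, Matrix.one_mul,
      show Tᵀᴴ = Tᴴᵀ from rfl, ← Matrix.transpose_mul, hTu.2, Matrix.transpose_one]
  have hYT : ∀ r c', ∑ c, star (Y r c) * T c c' = star (X r c') := by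
    have : Y * Tᴴᵀ = X := by
      rw [hY, Matrix.mul_assoc, ← Matrix.transpose_mul, hTu.1, Matrix.transpose_one,
        Matrix.mul_one]
    intro r c'
    rw [← this]
    simp [Matrix.mul_apply, mul_comm]
  have hcB : Fintype.card B = 2 * Fintype.card b := by
    simpa using (card_eq_of_isUnitaryMap hW).symm
  obtain ⟨J⟩ : Nonempty (H × (Fin 2 × b) ↪ S) :=
    Function.Embedding.nonempty_of_card_le (by simpa [hcB] using hcard)
  obtain ⟨Q, hQ, hQJ⟩ := exists_unitary_extending_columns (Set.range J)
    (Function.extend J (fun c r => Y r c) 0) (by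
      rintro _ ⟨c, rfl⟩ _ ⟨d, rfl⟩
      simp only [J.injective.extend_apply, J.injective.eq_iff]
      have := congrFun (congrFun hYY c) d
      rwa [Matrix.one_apply, Matrix.mul_apply] at this)
  have hQY : ∀ c r, Q r (J c) = Y r c := fun c r => by
    rw [hQJ _ ⟨c, rfl⟩, J.injective.extend_apply]
  -- The label `F` moves the qubit of a basis vector `J (h, p, k)` into the fresh qubit.
  classical
  set F : S → Fin 2 × S := Function.extend J (fun c => (c.2.1, J (c.1, (0, c.2.2))))
    (fun r => (0, r)) with hF
  have hFJ : ∀ c, F (J c) = (c.2.1, J (c.1, (0, c.2.2))) := fun c => J.injective.extend_apply _ _ c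
  have hFn : ∀ r, (¬ ∃ c, J c = r) → F r = (0, r) := fun r hr => Function.extend_apply' _ _ _ hr
  have hFi : Function.Injective F := by
    intro r r' h
    by_cases hr : ∃ c, J c = r <;> by_cases hr' : ∃ c, J c = r'
    · obtain ⟨⟨h1, p1, k1⟩, rfl⟩ := hr
      obtain ⟨⟨h2, p2, k2⟩, rfl⟩ := hr'
      rw [hFJ, hFJ] at h
      simp only [Prod.mk.injEq, J.injective.eq_iff] at h
      obtain ⟨rfl, rfl, -, rfl⟩ := h
      rfl
    · obtain ⟨c, rfl⟩ := hr
      rw [hFJ, hFn _ hr'] at h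
      exact absurd ⟨_, (Prod.mk.inj h).2⟩ hr'
    · obtain ⟨c, rfl⟩ := hr'
      rw [hFJ, hFn _ hr] at h
      exact absurd ⟨_, (Prod.mk.inj h).2.symm⟩ hr
    · rw [hFn _ hr, hFn _ hr'] at h
      exact (Prod.mk.inj h).2
  set E : Matrix (Fin 2 × S) S ℂ := Matrix.of fun x r => if x = F r then 1 else 0 with hE
  have hEE : Eᴴ * E = 1 := by
    ext r r'
    simp [hE, Matrix.mul_apply, Matrix.one_apply, hFi.eq_iff, eq_comm]
  have hVap : ∀ h p k r, (E * Qᴴ) (p, J (h, (0, k))) r = star (Y r (h, (p, k))) := by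
    intro h p k r
    have : ((p, J (h, (0, k))) : Fin 2 × S) = F (J (h, (p, k))) := by rw [hFJ]
    rw [this, ← hQY]
    simp [hE, Matrix.mul_apply, hFi.eq_iff]
  refine ⟨E * Qᴴ, ?_, ?_⟩
  · rw [IsIsometry, Matrix.conjTranspose_mul, Matrix.conjTranspose_conjTranspose,
      Matrix.mul_assoc, ← Matrix.mul_assoc Eᴴ, hEE, Matrix.one_mul]
    exact mul_eq_one_comm.mp hQ
  rw [bellFidelity_qubitPair]
  set θ : H → (Fin 2 × S) × (Fin 2 × b) → ℂ :=
    fun h => ((E * Qᴴ) ⊗ₖ W) *ᵥ fun p : S × B => Ψ (p.1, (h, p.2)) with hθ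
  have hsum : ∑ hk : H × b, ∑ p, θ hk.1 ((p, J (hk.1, (0, hk.2))), (p, hk.2)) =
      ∑ r, ∑ c, star (X r c) * Ψ (r, c) := by
    have hterm : ∀ h p k, θ h ((p, J (h, (0, k))), (p, k)) =
        ∑ r, ∑ c, star (Y r (h, (p, k))) * T (h, (p, k)) c * Ψ (r, c) := by
      intro h p k
      simp only [hθ, Matrix.mulVec, dotProduct, Fintype.sum_prod_type, Matrix.kroneckerMap_apply,
        hVap]
      refine Finset.sum_congr rfl fun r _ => ?_
      rw [Finset.sum_eq_single h]
      · simp [hT]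
      · intro h' _ hne
        simp [hT, hne.symm]
      · simp
    calc ∑ hk : H × b, ∑ p, θ hk.1 ((p, J (hk.1, (0, hk.2))), (p, hk.2))
        = ∑ c' : H × (Fin 2 × b), ∑ r, ∑ c, star (Y r c') * T c' c * Ψ (r, c) := by
          simp only [hterm, Fintype.sum_prod_type]
          exact Finset.sum_congr rfl fun h _ => Finset.sum_comm
      _ = _ := by
          rw [Finset.sum_comm]
          refine Finset.sum_congr rfl fun r _ => ?_
          rw [Finset.sum_comm]
          exact Finset.sum_congr rfl fun c _ => by rw [← Finset.sum_mul, hYT]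
  -- Restricting the fidelity to the vectors `|J (h, 0, k)⟩ |h⟩ |k⟩` and applying Cauchy-Schwarz to
  -- their `|H| |b|` amplitudes gives the bound.
  have hCS := norm_sum_sq_le_card_mul
    (fun hk : H × b => ∑ p, θ hk.1 ((p, J (hk.1, (0, hk.2))), (p, hk.2)))
  rw [hsum] at hCS
  have hle : ∑ hk : H × b, ‖∑ p, θ hk.1 ((p, J (hk.1, (0, hk.2))), (p, hk.2))‖ ^ 2 / 2 ≤
      ∑ h, ∑ s, ∑ k, ‖∑ p, θ h ((p, s), (p, k))‖ ^ 2 / 2 := by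
    rw [Fintype.sum_prod_type]
    refine Finset.sum_le_sum fun h _ => ?_
    rw [Finset.sum_comm]
    exact Finset.sum_le_sum fun k _ => Finset.single_le_sum
      (f := fun s => ‖∑ p, θ h ((p, s), (p, k))‖ ^ 2 / 2) (fun _ _ => by positivity)
      (Finset.mem_univ (J (h, (0, k))))
  refine le_trans ?_ hle
  rw [← Finset.sum_div]
  have hc : (Fintype.card (H × B) : ℝ) = 2 * Fintype.card (H × b) := by
    simp [hcB]; ring
  rw [hc]
  refine div_le_of_le_mul₀ (by positivity)
    (div_nonneg (Finset.sum_nonneg fun _ _ => by positivity) (by norm_num)) ?_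
  linear_combination hCS

/-! ### Polar decomposition -/

/-- The isometry of the polar decomposition of `M` overlaps with `M` by the sum of the singular
values `s` of `M`. These satisfy `∑ s² = 1` and `∑ s⁴ = tr (M†M)²`, which bounds their sum from
below by means of `s (s - c)² (s + 2c) ≥ 0` for `c = 1/√d`. -/
theorem exists_isometry_overlap {m n : Type} [Fintype m] [DecidableEq m] [Fintype n]
    [DecidableEq n] [Nonempty n] (hcard : Fintype.card n ≤ Fintype.card m) {M : Matrix m n ℂ}
    (htr : (Mᴴ * M).trace = 1) :
    ∃ X : Matrix m n ℂ, Xᴴ * X = 1 ∧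
      (3 - Fintype.card n * ((Mᴴ * M) * (Mᴴ * M)).trace.re) / 2 * Real.sqrt (Fintype.card n) ≤
        (Xᴴ * M).trace.re := by
  have hpsd := Matrix.posSemidef_conjTranspose_mul_self M
  set hA := hpsd.isHermitian
  set U : Matrix n n ℂ := (hA.eigenvectorUnitary : Matrix n n ℂ) with hU
  set l := hA.eigenvalues with hl
  have hl0 : ∀ i, 0 ≤ l i := hpsd.eigenvalues_nonneg
  have hUU : Uᴴ * U = 1 := Matrix.mem_unitaryGroup_iff'.mp hA.eigenvectorUnitary.2
  have hUU' : U * Uᴴ = 1 := Matrix.mem_unitaryGroup_iff.mp hA.eigenvectorUnitary.2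
  set D : Matrix n n ℂ := Matrix.diagonal fun i => (l i : ℂ) with hD
  have hspec : Mᴴ * M = U * D * Uᴴ := by
    have := hA.spectral_theorem
    rw [Unitary.conjStarAlgAut_apply] at this
    exact this
  have hND : (M * U)ᴴ * (M * U) = D := by
    rw [Matrix.conjTranspose_mul, Matrix.mul_assoc, ← Matrix.mul_assoc Mᴴ, hspec,
      Matrix.mul_assoc, Matrix.mul_assoc, hUU, Matrix.mul_one, ← Matrix.mul_assoc, hUU,
      Matrix.one_mul]
  set N := M * U with hN
  have hNN : ∀ a c, ∑ r, star (N r a) * N r c = if a = c then (l a : ℂ) else 0 := by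
    intro a c
    have := congrFun (congrFun hND a) c
    rwa [hD, Matrix.diagonal_apply, Matrix.mul_apply] at this
  have hsum1 : ∑ a, l a = 1 := by
    have h : (Mᴴ * M).trace = ∑ a, (l a : ℂ) := by
      rw [hspec, Matrix.trace_mul_comm, ← Matrix.mul_assoc, hUU, Matrix.one_mul, hD,
        Matrix.trace_diagonal]
    rw [htr] at h
    exact_mod_cast h.symm
  have hsum2 : ((Mᴴ * M) * (Mᴴ * M)).trace.re = ∑ a, l a ^ 2 := by
    have h : (Mᴴ * M) * (Mᴴ * M) = U * (D * D) * Uᴴ := by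
      rw [hspec]
      simp only [Matrix.mul_assoc]
      rw [← Matrix.mul_assoc Uᴴ, hUU, Matrix.one_mul]
    rw [h, Matrix.trace_mul_comm, ← Matrix.mul_assoc, hUU, Matrix.one_mul, hD,
      Matrix.diagonal_mul_diagonal, Matrix.trace_diagonal, Complex.re_sum]
    exact Finset.sum_congr rfl fun a _ => by rw [← Complex.ofReal_mul, Complex.ofReal_re, sq]
  -- The columns of `N` are orthogonal with norms `√l`. The nonzero ones, normalized, extend to a
  -- unitary matrix, whose columns labelled by `J` are the isometry in the eigenbasis.
  obtain ⟨J⟩ : Nonempty (n ↪ m) := Function.Embedding.nonempty_of_card_le hcard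
  obtain ⟨Q, hQ, hQJ⟩ := exists_unitary_extending_columns (J '' {a | l a ≠ 0})
    (Function.extend J (fun a r => ((Real.sqrt (l a))⁻¹ : ℝ) * N r a) 0) (by
      rintro _ ⟨a, ha, rfl⟩ _ ⟨c, hc, rfl⟩
      simp only [J.injective.extend_apply, J.injective.eq_iff]
      have h : ∀ r, star (((Real.sqrt (l a))⁻¹ : ℝ) * N r a) * (((Real.sqrt (l c))⁻¹ : ℝ) * N r c) =
          (((Real.sqrt (l a))⁻¹ : ℝ) * ((Real.sqrt (l c))⁻¹ : ℝ)) * (star (N r a) * N r c) := by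
        intro r
        rw [star_mul', Complex.star_def, Complex.conj_ofReal]
        ring
      rw [Finset.sum_congr rfl fun r _ => h r, ← Finset.mul_sum, hNN]
      split_ifs with hac
      · subst hac
        rw [← Complex.ofReal_mul, ← Complex.ofReal_mul, ← mul_inv, Real.mul_self_sqrt (hl0 a),
          inv_mul_cancel₀ ha, Complex.ofReal_one]
      · rw [mul_zero])
  set QJ : Matrix m n ℂ := Q.submatrix id J with hQJd
  have hQJQJ : QJᴴ * QJ = 1 := by
    have : QJᴴ * QJ = (Qᴴ * Q).submatrix J J := by
      ext a c
      simp [hQJd, Matrix.mul_apply]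
    rw [this, hQ]
    exact Matrix.submatrix_one _ J.injective
  have hcol : ∀ a, ∑ r, star (QJ r a) * N r a = (Real.sqrt (l a) : ℂ) := by
    intro a
    have haa := hNN a a
    rw [if_pos rfl] at haa
    by_cases ha : l a = 0
    · have hN0 : ∀ r, N r a = 0 := by
        have h : ∑ r, ‖N r a‖ ^ 2 = 0 := by
          rw [ha] at haa
          have h2 := congrArg Complex.re haa
          rw [Complex.re_sum] at h2
          simpa [← Complex.normSq_eq_norm_sq, Complex.normSq_apply] using h2
        intro r
        have := (Finset.sum_eq_zero_iff_of_nonneg fun _ _ => by positivity).mp h r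
          (Finset.mem_univ r)
        simpa using this
      simp [hN0, ha]
    · have h : ∀ r, QJ r a = ((Real.sqrt (l a))⁻¹ : ℝ) * N r a := by
        intro r
        have := hQJ (J a) ⟨a, ha, rfl⟩ r
        rwa [J.injective.extend_apply] at this
      have h2 : ∀ r, star (QJ r a) * N r a =
          ((Real.sqrt (l a))⁻¹ : ℝ) * (star (N r a) * N r a) := by
        intro r
        rw [h, star_mul', Complex.star_def, Complex.conj_ofReal]
        ring
      rw [Finset.sum_congr rfl fun r _ => h2 r, ← Finset.mul_sum, haa, ← Complex.ofReal_mul]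
      congr 1
      have : 0 < Real.sqrt (l a) := Real.sqrt_pos.mpr (lt_of_le_of_ne (hl0 a) (Ne.symm ha))
      field_simp
      exact (Real.sq_sqrt (hl0 a)).symm
  refine ⟨QJ * Uᴴ, ?_, ?_⟩
  · rw [Matrix.conjTranspose_mul, Matrix.conjTranspose_conjTranspose, Matrix.mul_assoc,
      ← Matrix.mul_assoc QJᴴ, hQJQJ, Matrix.one_mul, hUU']
  have hov : ((QJ * Uᴴ)ᴴ * M).trace.re = ∑ a, Real.sqrt (l a) := by
    rw [Matrix.conjTranspose_mul, Matrix.conjTranspose_conjTranspose, Matrix.mul_assoc,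
      Matrix.trace_mul_comm, Matrix.mul_assoc, ← hN]
    simp only [Matrix.trace, Matrix.diag_apply, Matrix.mul_apply, Matrix.conjTranspose_apply]
    rw [Finset.sum_congr rfl fun a _ => hcol a, Complex.re_sum]
    simp
  rw [hov, hsum2]
  have hd : 0 < (Fintype.card n : ℝ) := by exact_mod_cast Fintype.card_pos
  set d : ℝ := (Fintype.card n : ℝ) with hdd
  have hsd : 0 < Real.sqrt d := Real.sqrt_pos.mpr hd
  have hsq : Real.sqrt d ^ 2 = d := Real.sq_sqrt hd.le
  have key : ∀ a, (3 * l a - d * l a ^ 2) / 2 * Real.sqrt d ≤ Real.sqrt (l a) := by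
    intro a
    have hs := Real.sqrt_nonneg (l a)
    have hls : l a = Real.sqrt (l a) ^ 2 := (Real.sq_sqrt (hl0 a)).symm
    set s := Real.sqrt (l a)
    rw [hls]
    have : 0 ≤ s * (Real.sqrt d * s - 1) ^ 2 * (Real.sqrt d * s + 2) := by positivity
    linear_combination (1 / 2 : ℝ) * this + (s ^ 4 * Real.sqrt d / 2) * hsq
  calc (3 - d * ∑ a, l a ^ 2) / 2 * Real.sqrt d
      = ∑ a, (3 * l a - d * l a ^ 2) / 2 * Real.sqrt d := by
        rw [← Finset.sum_mul, ← Finset.sum_div, Finset.sum_sub_distrib, ← Finset.mul_sum,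
          ← Finset.mul_sum, hsum1, mul_one]
    _ ≤ _ := Finset.sum_le_sum fun a _ => key a

/-! ### Moments of Haar-random vectors and the typical purity -/

open MeasureTheory

instance isProbabilityMeasure_haarUnitary (n : Type) [Fintype n] [DecidableEq n] :
    IsProbabilityMeasure (haarUnitary n) :=
  ⟨Measure.haarMeasure_self (K₀ := ⊤)⟩

instance isMulLeftInvariant_haarUnitary (n : Type) [Fintype n] [DecidableEq n] :
    (haarUnitary n).IsMulLeftInvariant := by
  unfold haarUnitary; infer_instance

section Moments

variable {n : Type} [Fintype n] [DecidableEq n] (φ : n → ℂ)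

/-- The vector to which the unitary `U` takes `φ`. -/
def evolved (U : Matrix.unitaryGroup n ℂ) : n → ℂ := (U : Matrix n n ℂ) *ᵥ φ

theorem continuous_evolved : Continuous (evolved φ) :=
  Continuous.matrix_mulVec continuous_subtype_val continuous_const

theorem integrable_evolved {f : (n → ℂ) → ℝ} (hf : Continuous f) :
    Integrable (fun U => f (evolved φ U)) (haarUnitary n) :=
  (hf.comp (continuous_evolved φ)).integrable_of_hasCompactSupport
    (HasCompactSupport.of_compactSpace _)

theorem integral_mulVec_evolved (f : (n → ℂ) → ℝ) {g : Matrix n n ℂ} (hg : g * gᴴ = 1) :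
    ∫ U, f (g *ᵥ evolved φ U) ∂haarUnitary n = ∫ U, f (evolved φ U) ∂haarUnitary n := by
  have h := integral_mul_left_eq_self (μ := haarUnitary n) (fun U => f (evolved φ U))
    ⟨g, Matrix.mem_unitaryGroup_iff.mpr hg⟩
  rw [← h]
  refine integral_congr_ae (Filter.Eventually.of_forall fun U => ?_)
  simp [evolved, Matrix.mulVec_mulVec]

/-- A component that occurs only once averages to zero, by invariance under its sign change. -/
theorem integral_evolved_eq_zero {i j k l : n} (hj : j ≠ i) (hk : k ≠ i) (hl : l ≠ i) :
    ∫ U, (star (evolved φ U i) * evolved φ U j *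
      (star (evolved φ U k) * evolved φ U l)).re ∂haarUnitary n = 0 := by
  set g : Matrix n n ℂ := Matrix.diagonal fun x => if x = i then -1 else 1 with hg
  have hgg : g * gᴴ = 1 := by
    rw [hg, Matrix.diagonal_conjTranspose, Matrix.diagonal_mul_diagonal, ← Matrix.diagonal_one]
    congr 1
    ext x
    by_cases hx : x = i <;> simp [hx]
  have h := integral_mulVec_evolved φ
    (fun ψ => (star (ψ i) * ψ j * (star (ψ k) * ψ l)).re) hgg
  have h2 : ∀ U, (star ((g *ᵥ evolved φ U) i) * (g *ᵥ evolved φ U) j *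
      (star ((g *ᵥ evolved φ U) k) * (g *ᵥ evolved φ U) l)).re =
      -(star (evolved φ U i) * evolved φ U j * (star (evolved φ U k) * evolved φ U l)).re := by
    intro U
    simp only [hg, Matrix.mulVec_diagonal, if_neg hj, if_neg hk, if_neg hl, if_true]
    simp
  simp only [h2, integral_neg] at h
  linarith

/-- The fourth moment of a component is the same along every unit vector `v`, by transitivity of the
unitary group on the unit sphere. -/
theorem integral_norm_inner_evolved_pow_four (i : n) {v : n → ℂ} (hv : ∑ k, ‖v k‖ ^ 2 = 1) :
    ∫ U, ‖∑ k, star (v k) * evolved φ U k‖ ^ 4 ∂haarUnitary n =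
      ∫ U, ‖evolved φ U i‖ ^ 4 ∂haarUnitary n := by
  obtain ⟨Q, hQ, hQi⟩ := exists_unitary_extending_columns {i} (fun _ => v) (by
    rintro a rfl c rfl
    have h : ∀ k, star (v k) * v k = ((‖v k‖ ^ 2 : ℝ) : ℂ) := fun k => by
      rw [Complex.star_def, Complex.conj_mul', Complex.ofReal_pow]
    rw [if_pos rfl, Finset.sum_congr rfl fun k _ => h k, ← Complex.ofReal_sum, hv,
      Complex.ofReal_one])
  have h := integral_mulVec_evolved φ (fun ψ => ‖ψ i‖ ^ 4) (g := Qᴴ)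
    (by rwa [Matrix.conjTranspose_conjTranspose])
  rw [← h]
  refine integral_congr_ae (Filter.Eventually.of_forall fun U => ?_)
  simp [Matrix.mulVec, dotProduct, hQi i rfl]

theorem integral_norm_evolved_pow_four_eq (i j : n) :
    ∫ U, ‖evolved φ U j‖ ^ 4 ∂haarUnitary n = ∫ U, ‖evolved φ U i‖ ^ 4 ∂haarUnitary n := by
  rw [← integral_norm_inner_evolved_pow_four φ i (v := Pi.single j 1)]
  · refine integral_congr_ae (Filter.Eventually.of_forall fun U => ?_)
    simp [Pi.single_apply, apply_ite]
  · simp [Pi.single_apply, apply_ite]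

theorem integral_norm_add_evolved_pow_four {i j : n} (hij : i ≠ j) {ω : ℂ} (hω : ‖ω‖ = 1) :
    ∫ U, ‖evolved φ U i + ω * evolved φ U j‖ ^ 4 ∂haarUnitary n =
      4 * ∫ U, ‖evolved φ U i‖ ^ 4 ∂haarUnitary n := by
  have hs : Real.sqrt 2 ^ 2 = 2 := Real.sq_sqrt (by norm_num)
  set c : ℝ := (Real.sqrt 2)⁻¹ with hc
  have hc2 : c ^ 2 = 1 / 2 := by rw [hc, inv_pow, hs]; norm_num
  have hc0 : 0 ≤ c := by positivity
  rw [← integral_norm_inner_evolved_pow_four φ i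
    (v := fun k => (c : ℂ) * ((if k = i then 1 else 0) + if k = j then star ω else 0)),
    ← integral_const_mul]
  · refine integral_congr_ae (Filter.Eventually.of_forall fun U => ?_)
    have : ∑ k, star ((c : ℂ) * ((if k = i then 1 else 0) + if k = j then star ω else 0)) *
        evolved φ U k = c * (evolved φ U i + ω * evolved φ U j) := by
      have hk : ∀ k, star ((c : ℂ) * ((if k = i then 1 else 0) + if k = j then star ω else 0)) *
          evolved φ U k = (if k = i then (c : ℂ) * evolved φ U i else 0) +
            if k = j then (c : ℂ) * (ω * evolved φ U j) else 0 := by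
        intro k
        by_cases hki : k = i
        · simp [hki, hij]
        · by_cases hkj : k = j <;> simp [hki, hkj, hij.symm, mul_assoc]
      rw [Finset.sum_congr rfl fun k _ => hk k, Finset.sum_add_distrib]
      simp [mul_add]
    simp only [this]
    rw [norm_mul, Complex.norm_real, Real.norm_of_nonneg hc0, mul_pow,
      show c ^ 4 = (c ^ 2) ^ 2 by ring, hc2]
    ring
  · have h : ∀ k, ‖(c : ℂ) * ((if k = i then 1 else 0) + if k = j then star ω else 0)‖ ^ 2 =
        (if k = i then 1 / 2 else 0) + if k = j then 1 / 2 else 0 := by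
      intro k
      rw [norm_mul, mul_pow, Complex.norm_real, Real.norm_of_nonneg hc0, hc2]
      by_cases hki : k = i
      · have : k ≠ j := fun h => hij (hki ▸ h)
        simp [hki, hij]
      · by_cases hkj : k = j <;> simp [hki, hkj, hω, hij.symm]
    rw [Finset.sum_congr rfl fun k _ => h k, Finset.sum_add_distrib]
    simp
    norm_num

/-- Averaged over the phases `±1, ±i`, the cross terms of `|a + ω b|⁴` leave only `|a|² |b|²`. -/
theorem sum_norm_add_phase_mul_pow_four (a b : ℂ) :
    ‖a + 1 * b‖ ^ 4 + ‖a + -1 * b‖ ^ 4 + ‖a + Complex.I * b‖ ^ 4 + ‖a + -Complex.I * b‖ ^ 4 =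
      4 * ‖a‖ ^ 4 + 4 * ‖b‖ ^ 4 + 16 * (‖a‖ ^ 2 * ‖b‖ ^ 2) := by
  have h : ∀ z : ℂ, ‖z‖ ^ 4 = (z.re * z.re + z.im * z.im) ^ 2 := fun z => by
    rw [← Complex.normSq_apply, Complex.normSq_eq_norm_sq]; ring
  have h2 : ∀ z : ℂ, ‖z‖ ^ 2 = z.re * z.re + z.im * z.im := fun z => by
    rw [← Complex.normSq_apply, Complex.normSq_eq_norm_sq]
  simp only [h, h2]
  simp
  ring

theorem sum_norm_sq_evolved (hφ : star φ ⬝ᵥ φ = 1) (U : Matrix.unitaryGroup n ℂ) :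
    ∑ i, ‖evolved φ U i‖ ^ 2 = 1 := by
  have h : star (evolved φ U) ⬝ᵥ evolved φ U = 1 := by
    have hU : (U : Matrix n n ℂ)ᴴ * (U : Matrix n n ℂ) = 1 := Matrix.mem_unitaryGroup_iff'.mp U.2
    rw [evolved, Matrix.star_mulVec, ← Matrix.dotProduct_mulVec, Matrix.mulVec_mulVec, hU,
      Matrix.one_mulVec, hφ]
  have h2 := congrArg Complex.re h
  rw [dotProduct, Complex.re_sum] at h2
  simpa [← Complex.normSq_eq_norm_sq, Complex.normSq_apply] using h2

/-- The second moments of the squared components of a Haar-random unit vector. Polarization over four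
phases makes the mixed moment half of the fourth moment; normalization fixes the common scale. -/
theorem integral_norm_sq_mul_norm_sq_evolved (hφ : star φ ⬝ᵥ φ = 1) (i j : n) :
    ∫ U, ‖evolved φ U i‖ ^ 2 * ‖evolved φ U j‖ ^ 2 ∂haarUnitary n =
      (1 + if i = j then 1 else 0) / (Fintype.card n * (Fintype.card n + 1)) := by
  set α : ℝ := ∫ U, ‖evolved φ U i‖ ^ 4 ∂haarUnitary n with hα
  have hαj : ∀ k, ∫ U, ‖evolved φ U k‖ ^ 4 ∂haarUnitary n = α := fun k =>
    integral_norm_evolved_pow_four_eq φ i k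
  have hmom : ∀ k l, ∫ U, ‖evolved φ U k‖ ^ 2 * ‖evolved φ U l‖ ^ 2 ∂haarUnitary n =
      (1 + if k = l then 1 else 0) * (α / 2) := by
    intro k l
    by_cases hkl : k = l
    · subst hkl
      have h : ∀ U, ‖evolved φ U k‖ ^ 2 * ‖evolved φ U k‖ ^ 2 = ‖evolved φ U k‖ ^ 4 :=
        fun U => by ring
      simp only [h, hαj, if_true]
      ring
    · have hint : ∀ ω : ℂ, Integrable (fun U => ‖evolved φ U k + ω * evolved φ U l‖ ^ 4)
          (haarUnitary n) := fun ω =>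
        integrable_evolved φ (f := fun ψ => ‖ψ k + ω * ψ l‖ ^ 4) (by fun_prop)
      have hint4 : ∀ k, Integrable (fun U => 4 * ‖evolved φ U k‖ ^ 4) (haarUnitary n) := fun k =>
        integrable_evolved φ (f := fun ψ => 4 * ‖ψ k‖ ^ 4) (by fun_prop)
      have hint2 : Integrable (fun U => 16 * (‖evolved φ U k‖ ^ 2 * ‖evolved φ U l‖ ^ 2))
          (haarUnitary n) :=
        integrable_evolved φ (f := fun ψ => 16 * (‖ψ k‖ ^ 2 * ‖ψ l‖ ^ 2)) (by fun_prop)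
      have h : ∫ U, (‖evolved φ U k + 1 * evolved φ U l‖ ^ 4 +
          ‖evolved φ U k + -1 * evolved φ U l‖ ^ 4 +
          ‖evolved φ U k + Complex.I * evolved φ U l‖ ^ 4 +
          ‖evolved φ U k + -Complex.I * evolved φ U l‖ ^ 4) ∂haarUnitary n =
          ∫ U, (4 * ‖evolved φ U k‖ ^ 4 + 4 * ‖evolved φ U l‖ ^ 4 +
            16 * (‖evolved φ U k‖ ^ 2 * ‖evolved φ U l‖ ^ 2)) ∂haarUnitary n :=
        integral_congr_ae (Filter.Eventually.of_forall fun U =>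
          sum_norm_add_phase_mul_pow_four _ _)
      rw [integral_add (((hint _).fun_add (hint _)).fun_add (hint _)) (hint _),
        integral_add ((hint _).fun_add (hint _)) (hint _), integral_add (hint _) (hint _),
        integral_add ((hint4 _).fun_add (hint4 _)) hint2, integral_add (hint4 _) (hint4 _),
        integral_const_mul, integral_const_mul, integral_const_mul,
        integral_norm_add_evolved_pow_four φ hkl (by simp),
        integral_norm_add_evolved_pow_four φ hkl (by simp),
        integral_norm_add_evolved_pow_four φ hkl (by simp),
        integral_norm_add_evolved_pow_four φ hkl (by simp), hαj, hαj] at h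
      rw [if_neg hkl]
      linarith
  have htot : ∑ k : n, ∑ l : n, (1 + if k = l then (1 : ℝ) else 0) * (α / 2) = 1 := by
    have h1 : ∫ U, ∑ k, ∑ l, ‖evolved φ U k‖ ^ 2 * ‖evolved φ U l‖ ^ 2 ∂haarUnitary n = 1 := by
      have h : ∀ U, ∑ k, ∑ l, ‖evolved φ U k‖ ^ 2 * ‖evolved φ U l‖ ^ 2 = 1 := fun U => by
        rw [← Finset.sum_mul_sum, sum_norm_sq_evolved φ hφ, one_mul]
      simp [h]
    have hi : ∀ k l, Integrable (fun U => ‖evolved φ U k‖ ^ 2 * ‖evolved φ U l‖ ^ 2)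
        (haarUnitary n) := fun k l =>
      integrable_evolved φ (f := fun ψ => ‖ψ k‖ ^ 2 * ‖ψ l‖ ^ 2) (by fun_prop)
    rw [integral_finsetSum _ fun k _ => integrable_finsetSum _ fun l _ => hi k l] at h1
    refine Eq.trans ?_ h1
    refine Finset.sum_congr rfl fun k _ => ?_
    rw [integral_finsetSum _ fun l _ => hi k l]
    exact Finset.sum_congr rfl fun l _ => (hmom k l).symm
  have hD : (0 : ℝ) < Fintype.card n := by
    have : Nonempty n := ⟨i⟩
    exact_mod_cast Fintype.card_pos
  simp only [← Finset.sum_mul, Finset.sum_add_distrib, Finset.sum_const, Finset.card_univ,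
    Finset.sum_ite_eq, Finset.mem_univ, if_true, nsmul_eq_mul, mul_one] at htot
  rw [hmom, eq_div_iff (by positivity)]
  linear_combination (1 + if i = j then (1 : ℝ) else 0) * htot

end Moments

section Purity

variable {R R' : Type} [Fintype R] [Fintype R']

/-- The purity `tr ρ²` of the state `ρ` of the second factor, for the joint vector `ψ`. -/
def purity (ψ : R × R' → ℂ) : ℝ :=
  (((Matrix.of fun r a => ψ (r, a))ᴴ * Matrix.of fun r a => ψ (r, a)) *
    ((Matrix.of fun r a => ψ (r, a))ᴴ * Matrix.of fun r a => ψ (r, a))).trace.re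

theorem purity_eq (ψ : R × R' → ℂ) :
    purity ψ = ∑ a, ∑ c, ∑ r, ∑ s,
      (star (ψ (r, a)) * ψ (r, c) * (star (ψ (s, c)) * ψ (s, a))).re := by
  simp only [purity, Matrix.trace, Matrix.diag_apply, Matrix.mul_apply, Matrix.conjTranspose_apply,
    Matrix.of_apply, Finset.sum_mul_sum, Complex.re_sum]

/-- The reduced state has trace one, and its purity is least for the maximally mixed state. -/
theorem trace_eq_one_and_one_le_card_mul_purity {ψ : R × R' → ℂ} [DecidableEq R'] [Nonempty R']
    (hψ : ∑ i, ‖ψ i‖ ^ 2 = 1) :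
    ((Matrix.of fun r a => ψ (r, a))ᴴ * Matrix.of fun r a => ψ (r, a)).trace = 1 ∧
      1 ≤ Fintype.card R' * purity ψ := by
  have htr : ((Matrix.of fun r a => ψ (r, a))ᴴ * Matrix.of fun r a => ψ (r, a)).trace = 1 := by
    rw [Fintype.sum_prod_type, Finset.sum_comm] at hψ
    have h : ∀ z : ℂ, star z * z = ((‖z‖ ^ 2 : ℝ) : ℂ) := fun z => by
      rw [Complex.star_def, Complex.conj_mul', Complex.ofReal_pow]
    simp only [Matrix.trace, Matrix.diag_apply, Matrix.mul_apply, Matrix.conjTranspose_apply,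
      Matrix.of_apply, h]
    exact_mod_cast hψ
  refine ⟨htr, ?_⟩
  rw [purity]
  set ρ := (Matrix.of fun r a => ψ (r, a))ᴴ * Matrix.of fun r a => ψ (r, a) with hρ
  have hρH : ρᴴ = ρ := by simp [hρ]
  have hd : (0 : ℝ) < Fintype.card R' := by exact_mod_cast Fintype.card_pos
  set d : ℝ := (Fintype.card R' : ℝ) with hdd
  -- The square of the Hermitian matrix `d ρ - 1` has nonnegative trace.
  have h := (Matrix.posSemidef_conjTranspose_mul_self ((d : ℂ) • ρ - 1)).trace_nonneg
  have hexp : (((d : ℂ) • ρ - 1)ᴴ * ((d : ℂ) • ρ - 1)).trace = d * (d * (ρ * ρ).trace - 1) := by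
    rw [Matrix.conjTranspose_sub, Matrix.conjTranspose_smul, hρH, Matrix.conjTranspose_one,
      Complex.star_def, Complex.conj_ofReal]
    simp only [sub_mul, mul_sub, Matrix.smul_mul, Matrix.mul_smul, Matrix.one_mul, Matrix.mul_one,
      Matrix.trace_sub, Matrix.trace_smul, Matrix.trace_one, htr, smul_eq_mul, hdd]
    push_cast
    ring
  rw [hexp] at h
  have h2 := (Complex.nonneg_iff.mp h).1
  rw [Complex.re_ofReal_mul, Complex.sub_re, Complex.re_ofReal_mul, Complex.one_re] at h2
  linarith [nonneg_of_mul_nonneg_right h2 hd]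

variable [DecidableEq R] [DecidableEq R']

/-- The only terms of the purity that survive the average are those in which the components pair up
with their conjugates. -/
theorem integral_purity_term {φ : R × R' → ℂ} (hφ : star φ ⬝ᵥ φ = 1) (a c : R') (r s : R) :
    ∫ U, (star (evolved φ U (r, a)) * evolved φ U (r, c) *
      (star (evolved φ U (s, c)) * evolved φ U (s, a))).re ∂haarUnitary (R × R') =
      ((if a = c then 1 else 0) + if r = s then 1 else 0) /
        (Fintype.card (R × R') * (Fintype.card (R × R') + 1)) := by
  have hre : ∀ z w : ℂ, (star z * z * (star w * w)).re = ‖z‖ ^ 2 * ‖w‖ ^ 2 := fun z w => by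
    simp only [Complex.star_def, Complex.conj_mul']
    norm_cast
  have hre' : ∀ z w : ℂ, (star z * w * (star w * z)).re = ‖z‖ ^ 2 * ‖w‖ ^ 2 := fun z w => by
    rw [← hre]; congr 1; ring
  by_cases hac : a = c
  · subst hac
    simp only [hre, integral_norm_sq_mul_norm_sq_evolved φ hφ]
    simp
  · by_cases hrs : r = s
    · subst hrs
      simp only [hre', integral_norm_sq_mul_norm_sq_evolved φ hφ]
      simp [hac]
    · rw [integral_evolved_eq_zero φ (by simp [Ne.symm hac]) (by simp [Ne.symm hrs])
        (by simp [Ne.symm hrs])]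
      simp [hac, hrs]

/-- The average purity of a subsystem of a system in a Haar-random pure state. -/
theorem integral_purity {φ : R × R' → ℂ} (hφ : star φ ⬝ᵥ φ = 1) [Nonempty R] [Nonempty R'] :
    ∫ U, purity (evolved φ U) ∂haarUnitary (R × R') =
      (Fintype.card R + Fintype.card R') / (Fintype.card R * Fintype.card R' + 1) := by
  have hi : ∀ (a c : R') (r s : R), Integrable (fun U => (star (evolved φ U (r, a)) *
      evolved φ U (r, c) * (star (evolved φ U (s, c)) * evolved φ U (s, a))).re)
      (haarUnitary (R × R')) := fun a c r s =>
    integrable_evolved φ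
      (f := fun ψ => (star (ψ (r, a)) * ψ (r, c) * (star (ψ (s, c)) * ψ (s, a))).re)
      (Complex.continuous_re.comp (by fun_prop))
  simp only [purity_eq]
  rw [integral_finsetSum _ fun a _ => integrable_finsetSum _ fun c _ => integrable_finsetSum _
    fun r _ => integrable_finsetSum _ fun s _ => hi a c r s]
  simp_rw [integral_finsetSum _ fun c _ => integrable_finsetSum _
    fun r _ => integrable_finsetSum _ fun s _ => hi _ c r s,
    integral_finsetSum _ fun r _ => integrable_finsetSum _ fun s _ => hi _ _ r s,
    integral_finsetSum _ fun s _ => hi _ _ _ s, integral_purity_term hφ]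
  have hR : (0 : ℝ) < Fintype.card R := by exact_mod_cast Fintype.card_pos
  have hR' : (0 : ℝ) < Fintype.card R' := by exact_mod_cast Fintype.card_pos
  simp only [← Finset.sum_div, Finset.sum_add_distrib, Finset.sum_const, Finset.sum_ite_eq,
    Finset.mem_univ, if_true, Finset.card_univ, nsmul_eq_mul, mul_one, mul_ite, mul_zero,
    Fintype.card_prod, Nat.cast_mul]
  field_simp

/-- When the second factor is much smaller than the first, its state is nearly maximally mixed, with
high probability: the purity exceeds its minimum by at most `1 / dim R` on average, and Markov's
inequality applies. -/
theorem haarUnitary_purity_le {φ : R × R' → ℂ} (hφ : star φ ⬝ᵥ φ = 1) {K t δ : ℝ} (hK : 0 < K)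
    (ht : 0 < t) (hδ : 1 ≤ K * t * δ)
    (hcard : K * (Fintype.card R' : ℝ) ≤ (Fintype.card R : ℝ)) :
    haarUnitary (R × R') {U | t ≤ Fintype.card R' * purity (evolved φ U) - 1} ≤
      ENNReal.ofReal δ := by
  have hne : Nonempty (R × R') := by
    by_contra hne
    rw [not_nonempty_iff] at hne
    simp [dotProduct] at hφ
  have : Nonempty R := hne.map Prod.fst
  have : Nonempty R' := hne.map Prod.snd
  have hint : Integrable (fun U => purity (evolved φ U)) (haarUnitary (R × R')) :=
    integrable_evolved φ (f := purity) (by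
      simp only [funext purity_eq]
      refine continuous_finsetSum _ fun a _ => continuous_finsetSum _ fun c _ =>
        continuous_finsetSum _ fun r _ => continuous_finsetSum _ fun s _ =>
        Complex.continuous_re.comp (by fun_prop))
  have hM := mul_meas_ge_le_integral_of_nonneg (μ := haarUnitary (R × R'))
    (f := fun U => Fintype.card R' * purity (evolved φ U) - 1)
    (Filter.Eventually.of_forall fun U => by
      have := (trace_eq_one_and_one_le_card_mul_purity (sum_norm_sq_evolved φ hφ U)).2
      simp only [Pi.zero_apply]
      linarith) ((hint.const_mul _).sub (integrable_const _)) t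
  rw [integral_sub (hint.const_mul _) (integrable_const _), integral_const_mul,
    integral_purity hφ] at hM
  have hR : (0 : ℝ) < Fintype.card R := by exact_mod_cast Fintype.card_pos
  have hR' : (0 : ℝ) < Fintype.card R' := by exact_mod_cast Fintype.card_pos
  set d : ℝ := (Fintype.card R : ℝ)
  set d' : ℝ := (Fintype.card R' : ℝ)
  have hbound : d' * ((d + d') / (d * d' + 1)) - ∫ _, (1 : ℝ) ∂haarUnitary (R × R') ≤ 1 / K := by
    simp only [integral_const, probReal_univ, smul_eq_mul, mul_one]
    have hle : d' * ((d + d') / (d * d' + 1)) - 1 ≤ d' / d := by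
      rw [sub_le_iff_le_add, ← mul_div_assoc, div_add_one hR.ne', div_le_div_iff₀ (by positivity) hR]
      nlinarith
    refine hle.trans ?_
    rw [div_le_div_iff₀ hR hK]
    linarith
  rw [← ENNReal.ofReal_toReal (measure_ne_top _ _)]
  refine ENNReal.ofReal_le_ofReal ?_
  have h1 := hM.trans hbound
  have h2 : 1 / K ≤ t * δ := by
    rw [div_le_iff₀ hK]
    linarith
  exact le_of_mul_le_mul_left (h1.trans h2) ht

end Purity

/-! ### What the physicists infer -/

/-- No quantum state makes both test outcomes more probable than the uncertainty relation allows. -/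
theorem not_certainToWin {R R' A B H : Type} {η : ℝ} (hη : 1 / 2 + 1 / Real.sqrt 8 < 1 - η)
    {r : Run R R' A B H} (hT : QuantumTests η r) : ¬ CertainToWin r := by
  rintro ⟨h0, h1⟩
  obtain ⟨ρ, hρ, hb⟩ := hT .alice
  have h := born_add_born_le hρ.1 r.prediction.1 r.prediction.2
  rw [hρ.2, Complex.one_re, mul_one] at h
  have e : 2 / Real.sqrt 8 = 2 * (1 / Real.sqrt 8) := by ring
  linarith [hb _ _ h0, hb _ _ h1]

/-- The vacuum amplitudes form a unit vector that is flat up to the factor `exp (-π w)`; the same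
factor then bounds its overlap with the constant unit vector. -/
theorem exp_le_sq_sum_amplitude {B : Type} [Fintype B] [Nonempty B] {E : B → ℝ} {w : ℝ}
    (hE : ∀ m n, |E m - E n| ≤ w) :
    Real.exp (-(Real.pi * w)) ≤
      (∑ n, Real.exp (-Real.pi * E n) / Real.sqrt (∑ n, Real.exp (-2 * Real.pi * E n))) ^ 2 /
        Fintype.card B := by
  set Z : ℝ := ∑ n, Real.exp (-2 * Real.pi * E n) with hZ
  have hZ0 : 0 < Z := Finset.sum_pos (fun _ _ => Real.exp_pos _) Finset.univ_nonempty
  have hd : (0 : ℝ) < Fintype.card B := by exact_mod_cast Fintype.card_pos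
  have hflat : ∀ n m, Real.exp (-(Real.pi * w)) * Real.exp (-2 * Real.pi * E m) ≤
      Real.exp (-Real.pi * E n) * Real.exp (-Real.pi * E m) := by
    intro n m
    rw [← Real.exp_add, ← Real.exp_add, Real.exp_le_exp]
    nlinarith [Real.pi_pos, (abs_le.mp (hE n m)).2]
  have hsum : Real.exp (-(Real.pi * w)) * (Fintype.card B * Z) ≤
      (∑ n, Real.exp (-Real.pi * E n)) ^ 2 := by
    have h := Finset.sum_le_sum fun n (_ : n ∈ Finset.univ) =>
      Finset.sum_le_sum fun m (_ : m ∈ Finset.univ) => hflat n m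
    simp only [← Finset.sum_mul_sum] at h
    rw [sq]
    refine le_trans (le_of_eq ?_) h
    rw [Finset.sum_const, Finset.card_univ, nsmul_eq_mul, ← hZ]
    ring
  rw [← Finset.sum_div, div_pow, Real.sq_sqrt hZ0.le, div_div, le_div_iff₀ (by positivity),
    mul_comm Z]
  exact hsum

/-- Alice can undo the pairing of the horizon modes, up to the non-uniformity of the vacuum. -/
theorem exists_alice_distillation {A B b : Type} [Fintype A] [Fintype B] [Fintype b]
    [DecidableEq A] [DecidableEq B] [DecidableEq b] [Nonempty B] (G : Horizon A B b) {w : ℝ}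
    (hw : ∀ m n, |G.energy m - G.energy n| ≤ w) :
    ∃ V : Matrix (Fin 2 × A) A ℂ, IsIsometry V ∧ Real.exp (-(Real.pi * w)) ≤
      bellFidelity (qubitPair V G.refQubit (pureState (vacuum G))) := by
  set X : Matrix A (Unit × B) ℂ := Matrix.of fun a c => if a = G.partner c.2 then 1 else 0 with hX
  have hXX : Xᴴ * X = 1 := by
    ext ⟨_, m⟩ ⟨_, n⟩
    simp [hX, Matrix.mul_apply, Matrix.one_apply, eq_comm]
  obtain ⟨V, hV, hF⟩ := exists_distillation G.refQubit_unitary hXX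
    (by simp [Fintype.card_congr G.partner]) (fun p => vacuum G (p.1, p.2.2))
  refine ⟨V, hV, (exp_le_sq_sum_amplitude hw).trans ?_⟩
  have hov : ∑ r, ∑ c, star (X r c) * vacuum G (r, c.2) = ((∑ n, Real.exp (-Real.pi * G.energy n) /
      Real.sqrt (∑ n, Real.exp (-2 * Real.pi * G.energy n)) : ℝ) : ℂ) := by
    rw [Finset.sum_comm, Fintype.sum_prod_type, Complex.ofReal_sum]
    simp [hX, vacuum]
  rw [hov, Complex.norm_real, Real.norm_eq_abs, sq_abs] at hF
  simpa using hF

/-- If the state of the late radiation is close to maximally mixed, then Bob can distil from the early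
radiation a qubit entangled with any qubit of the zone, whatever the decomposition `R' ≃ H ⊗ B`. -/
theorem exists_bob_distillation {R R' A B H b : Type} [Fintype R] [Fintype R'] [Fintype B]
    [Fintype H] [Fintype b] [DecidableEq R] [DecidableEq R'] [DecidableEq B] [DecidableEq H]
    [DecidableEq b] [Nonempty R'] {G : Horizon A B b}
    {φ : R × R' → ℂ} (hφ : star φ ⬝ᵥ φ = 1) {U : Matrix.unitaryGroup (R × R') ℂ} {t : ℝ}
    (ht : t ≤ 1)
    (hcard : Fintype.card R' ≤ Fintype.card R)
    (hp : Fintype.card R' * purity (evolved φ U) - 1 ≤ t) {r : Run R R' A B H}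
    (hU : UnitaryEvaporation φ U r) (hE : EffectiveFieldTheory r) :
    ∃ V : Matrix (Fin 2 × R) R ℂ, IsIsometry V ∧
      1 - t ≤ bellFidelity (qubitPair V G.refQubit (bobReduced r)) := by
  obtain ⟨V, hV, hpres⟩ := hE
  set M : Matrix R R' ℂ := Matrix.of fun s a => evolved φ U (s, a) with hM
  obtain ⟨htr, -⟩ := trace_eq_one_and_one_le_card_mul_purity (sum_norm_sq_evolved φ hφ U)
  obtain ⟨X, hX, hov⟩ := exists_isometry_overlap hcard htr
  have hVV : Vᵀ * Vᵀᴴ = 1 ∧ Vᵀᴴ * Vᵀ = 1 := by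
    rw [show Vᵀᴴ = Vᴴᵀ from rfl, ← Matrix.transpose_mul, ← Matrix.transpose_mul, hV.1, hV.2,
      Matrix.transpose_one, Matrix.transpose_one]
    exact ⟨rfl, rfl⟩
  have hXV : (X * Vᵀ)ᴴ * (X * Vᵀ) = 1 := by
    rw [Matrix.conjTranspose_mul, Matrix.mul_assoc, ← Matrix.mul_assoc Xᴴ, hX, Matrix.one_mul,
      hVV.2]
  have hcardHB : Fintype.card (H × B) = Fintype.card R' := card_eq_of_isUnitaryMap hV
  obtain ⟨D, hD, hF⟩ := exists_distillation G.refQubit_unitary hXV (hcardHB ▸ hcard)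
    (((1 : Matrix R R ℂ) ⊗ₖ V) *ᵥ evolved φ U)
  refine ⟨D, hD, ?_⟩
  have hred : bobReduced r = ∑ h, pureState fun p : R × B =>
      (((1 : Matrix R R ℂ) ⊗ₖ V) *ᵥ evolved φ U) (p.1, (h, p.2)) := by
    rw [UnitaryEvaporation] at hU
    rw [hU, mul_pureState_mul_conjTranspose] at hpres
    ext p q
    simp [bobReduced, hpres, pureState, Matrix.vecMulVec_apply, Matrix.sum_apply, evolved]
  -- As a matrix, the present vector is the future one times the transpose of `V`.
  have hΨ : ∀ s c, (((1 : Matrix R R ℂ) ⊗ₖ V) *ᵥ evolved φ U) (s, c) = (M * Vᵀ) s c := by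
    intro s c
    simp only [Matrix.mulVec, dotProduct, Fintype.sum_prod_type, Matrix.kroneckerMap_apply,
      Matrix.mul_apply, Matrix.transpose_apply, hM, Matrix.of_apply]
    rw [Finset.sum_eq_single s (fun s' _ hs => by simp [hs.symm]) (by simp)]
    simp [mul_comm]
  have htrace : ∑ s, ∑ c, star ((X * Vᵀ) s c) * (((1 : Matrix R R ℂ) ⊗ₖ V) *ᵥ evolved φ U) (s, c) =
      (Xᴴ * M).trace := by
    have h : (Xᴴ * M).trace = ((X * Vᵀ)ᴴ * (M * Vᵀ)).trace := by
      rw [Matrix.conjTranspose_mul, Matrix.mul_assoc, Matrix.trace_mul_comm Vᵀᴴ, Matrix.mul_assoc,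
        Matrix.mul_assoc, hVV.1, Matrix.mul_one]
    rw [h, Finset.sum_comm]
    simp only [hΨ, Matrix.trace, Matrix.diag_apply, Matrix.conjTranspose_apply,
      Matrix.mul_apply (M := (X * Vᵀ)ᴴ)]
  rw [htrace, hcardHB, ← hred] at hF
  refine le_trans ?_ hF
  have hd : (0 : ℝ) < Fintype.card R' := by exact_mod_cast Fintype.card_pos
  have hsq : Real.sqrt (Fintype.card R') ^ 2 = Fintype.card R' := Real.sq_sqrt hd.le
  change (3 - Fintype.card R' * purity (evolved φ U)) / 2 * _ ≤ _ at hov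
  set x : ℝ := Fintype.card R' * purity (evolved φ U)
  have hnorm := hov.trans (Complex.re_le_norm _)
  rw [le_div_iff₀ hd]
  calc (1 - t) * Fintype.card R' ≤ ((3 - x) / 2) ^ 2 * Fintype.card R' := by
        gcongr
        -- `((3 - x) / 2)² ≥ 2 - x ≥ 1 - t`
        nlinarith [sq_nonneg (x - 1)]
    _ = ((3 - x) / 2 * Real.sqrt (Fintype.card R')) ^ 2 := by rw [mul_pow, hsq]
    _ ≤ _ := by
        have : 0 ≤ (3 - x) / 2 := by linarith
        gcongr

/-- Alice infers the computational test from her own outcome. For the diagonal test she simulates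
Bob's inference from his outcome, and adopts his certainty because the register he has sent is
classical for her. -/
theorem certainToWin {R R' A B H b : Type} [Fintype R] [Fintype R'] [Fintype A] [Fintype B]
    [Fintype H] [Fintype b] [DecidableEq R] [DecidableEq A] [DecidableEq B] [DecidableEq b]
    {η : ℝ} (hη : η ≤ 1 / 4) {G : Horizon A B b} {r : Run R R' A B H}
    (hX : Executed η G r) (hQ : QuantumReasoning η G r) (hC : Consistency r)
    (hA : 1 - η / 4 ≤ bellFidelity (pairState G r .alice))
    (hB : 1 - η / 4 ≤ bellFidelity (pairState G r .bob)) : CertainToWin r := by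
  have hW := G.refQubit_unitary.1
  have sA : IsState (pairState G r .alice) :=
    isState_qubitPair hX.alice_distils.1 hW hQ.alice_state
  have sB : IsState (pairState G r .bob) :=
    isState_qubitPair hX.bob_distils.1 hW (isState_bobReduced hQ.bob_present_state)
  have hcl : IsClassical (r.memory .alice .bob) :=
    ⟨1, one_mem _, fun ρ hρ => by simpa using hX.bob_classical ρ hρ⟩
  rw [CertainToWin, hX.alice_predicts]
  exact ⟨hQ.own _ _ _ _ hX.alice_records (le_born_update sA hη hA _ _),
    hC _ _ (by simp) hcl _ _
      (hQ.simulate _ _ _ _ _ hX.alice_reads.2 (le_born_update sB hη hB _ _))⟩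

/-- For every evolution that leaves the late radiation close to maximally mixed, the assumptions clash.
The spread `η / (4π)` of the boost energies costs Alice at most the fidelity `η / 4`. -/
theorem paradox_of_purity_le {R R' : Type} [Fintype R] [Fintype R'] [DecidableEq R]
    [DecidableEq R'] {η : ℝ} (hη : 1 / 2 + 1 / Real.sqrt 8 < 1 - η) {φ : R × R' → ℂ}
    (hφ : star φ ⬝ᵥ φ = 1) {U : Matrix.unitaryGroup (R × R') ℂ}
    (hcard : Fintype.card R' ≤ Fintype.card R)
    (hp : Fintype.card R' * purity (evolved φ U) - 1 ≤ η / 4) :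
    Paradox η (η / (4 * Real.pi)) φ U := by
  have hR' : Nonempty R' := by
    by_contra hne
    rw [not_nonempty_iff] at hne
    simp [dotProduct] at hφ
  -- The gap below the optimal winning probability is `1/2 - 1/√8 ≈ 0.146`.
  have hη4 : η ≤ 1 / 4 := by
    have h3 : Real.sqrt 8 ≤ 4 := Real.sqrt_le_iff.mpr (by norm_num)
    have : (1 : ℝ) / 4 ≤ 1 / Real.sqrt 8 := one_div_le_one_div_of_le (by positivity) h3
    linarith
  intro A B H b _ _ _ _ _ _ _ _ _ G hw r
  have hA : Executed η G r → NoDrama G r → 1 - η / 4 ≤ bellFidelity (pairState G r .alice) := by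
    intro hX hN
    obtain ⟨V, hV, hF⟩ := exists_alice_distillation G hw
    refine hX.alice_distils.2 ⟨V, hV, ?_⟩
    rw [hN]
    refine le_trans ?_ hF
    have hπ := Real.pi_ne_zero
    have e : Real.pi * (η / (4 * Real.pi)) = η / 4 := by field_simp
    rw [e]
    exact Real.one_sub_le_exp_neg _
  have hB : Executed η G r → UnitaryEvaporation φ U r → EffectiveFieldTheory r →
      1 - η / 4 ≤ bellFidelity (pairState G r .bob) := fun hX hU hE =>
    hX.bob_distils.2 (exists_bob_distillation hφ (by linarith) hcard hp hU hE)
  refine ⟨hA, hB, fun hX hQ hN hU hE hC => certainToWin hη4 hX hQ hC (hA hX hN) (hB hX hU hE), ?_⟩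
  rintro ⟨hX, ⟨hQ, hT⟩, ⟨hN, hU, hE⟩, hC⟩
  exact not_certainToWin hη hT (certainToWin hη4 hX hQ hC (hA hX hN) (hB hX hU hE))

end Firewall

theorem theorem5 :
    (∀ σ : Fin 2 → Fin 2 → Matrix (Fin 2) (Fin 2) ℂ, Firewall.IsStrategy σ →
      Firewall.winProb σ ≤ 1 / 2 + 1 / Real.sqrt 8) ∧
    ∀ η : ℝ, 0 < η → 1 / 2 + 1 / Real.sqrt 8 < 1 - η →
      ∃ w : ℝ, 0 < w ∧ ∀ δ : ℝ, 0 < δ → ∃ K : ℝ, 1 ≤ K ∧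
        ∀ (R R' : Type) [Fintype R] [Fintype R'] [DecidableEq R] [DecidableEq R']
          (φ : R × R' → ℂ), star φ ⬝ᵥ φ = 1 →
          K * (Fintype.card R' : ℝ) ≤ (Fintype.card R : ℝ) →
          Firewall.haarUnitary (R × R') {U | ¬ Firewall.Paradox η w φ U} ≤ ENNReal.ofReal δ := by
  refine ⟨fun σ => Firewall.winProb_le, fun η hη0 hη =>
    ⟨η / (4 * Real.pi), by have := Real.pi_pos; positivity, fun δ hδ =>
    ⟨max 1 (4 / (η * δ)), le_max_left _ _, fun R R' _ _ _ _ φ hφ hcard => ?_⟩⟩⟩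
  have hK1 : (1 : ℝ) ≤ max 1 (4 / (η * δ)) := le_max_left _ _
  have hKδ : 4 / (η * δ) ≤ max 1 (4 / (η * δ)) := le_max_right _ _
  set K : ℝ := max 1 (4 / (η * δ))
  have hcard' : Fintype.card R' ≤ Fintype.card R := by
    have : (Fintype.card R' : ℝ) ≤ Fintype.card R :=
      (le_mul_of_one_le_left (Nat.cast_nonneg _) hK1).trans hcard
    exact_mod_cast this
  refine le_trans (MeasureTheory.measure_mono fun U hU => ?_)
    (Firewall.haarUnitary_purity_le hφ (t := η / 4) (by linarith) (by positivity) ?_ hcard)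
  · by_contra h
    exact hU (Firewall.paradox_of_purity_le hη hφ hcard' (not_le.mp h).le)
  · rw [div_le_iff₀ (by positivity)] at hKδ
    linarith
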